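/- For $d\ge 2$, let $h$ be the whole-space log-correlated Gaussian field on $\mathbb R^d$: a random tempered distribution such that $((h,f))_f$, with $f$ ranging over Schwartz functions of integral zero, is a centered Gaussian process with $$\mathrm{Cov}[(h,f_1),(h,f_2)]=\int_{\mathbb R^d\times\mathbb R^d} f_1(x)f_2(y)\log\frac1{|x-y|}\,dx\,dy ,$$ normalized so that its average over the unit sphere is $0$. For $\varepsilon>0$ and $x\in\mathbb R^d$, let $h_\varepsilon(x)$ be the average of $h$ over the box $x+[-\varepsilon,\varepsilon]^d$. (Averages of $h$ over the sphere or over a box are $L^2$-limits of $h$ tested against smooth mollifications of the corresponding uniform probability measure.) For $\xi\ge 0$, a set $A\subset\varepsilon\mathbb Z^d$ and $z,w\in A$, let $$D_h^{\varepsilon,\xi}(z,w;A)=\inf_P\sum_{i=1}^{N}\varepsilon\, e^{\xi h_\varepsilon(P(i))},$$ where the infimum is over all nearest-neighbour paths $P=(P(1),\dots,P(N))$ in $A$, $N\ge1$, with $P(1)=z$ and $P(N)=w$; the distance between two subsets of $A$ is the infimum of the distances between their points, and an infimum over the empty set is $+\infty$. Let $\mathbb S^\varepsilon=[0,1]^d\cap\varepsilon\mathbb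 Z^d$, $\partial_L\mathbb S^\varepsilon=(\{0\}\times[0,1]^{d-1})\cap\varepsilon\mathbb Z^d$ and $\partial_R\mathbb S^\varepsilon=(\{1\}\times[0,1]^{d-1})\cap\varepsilon\mathbb Z^d$, and define $$\lambda(d,\xi)=\sup\Big\{\alpha\in\mathbb R:\ \liminf_{\varepsilon\to0}\mathbb P\big[D_h^{\varepsilon,\xi}(\partial_L\mathbb S^\varepsilon,\partial_R\mathbb S^\varepsilon;\mathbb S^\varepsilon)\le\varepsilon^\alpha\big]=1\Big\},$$ where $\varepsilon\to0$ along the reciprocals of positive integers and the supremum is taken in $[-\infty,\infty]$. Then for all integers $\widetilde d>d\ge2$ and all $\xi\ge0$, $$\lambda(\widetilde d,\xi)\ge\lambda(d,\xi).$$ -/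

import Mathlib

open MeasureTheory ProbabilityTheory Filter Topology
open scoped ENNReal SchwartzMap

namespace LFPP

/-- The space `ℝ^d` with its Euclidean norm. -/
abbrev E (d : ℕ) : Type := EuclideanSpace ℝ (Fin d)

/-! ### The log-correlated Gaussian field -/

section Field

variable {Ω : Type*} [MeasurableSpace Ω] {d : ℕ}

/-- A smooth bump supported in the ball of radius `1/(n+1)` around the origin; its normalization
`(bump d n).normed volume` is a nonnegative, even mollifier of integral one. -/
noncomputable def bump (d n : ℕ) : ContDiffBump (0 : E d) where
  rIn := 1 / (2 * ((n : ℝ) + 1))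
  rOut := 1 / ((n : ℝ) + 1)
  rIn_pos := by positivity
  rIn_lt_rOut := by
    have h : (0 : ℝ) < (n : ℝ) + 1 := by positivity
    exact one_div_lt_one_div_of_lt h (by linarith)

/-- `X` is the average of the random generalized function `h` with respect to the (normalized)
measure `ν`: it is the limit in `L²(P)` of `h` paired with the mollifications
`x ↦ ∫ η_n(x - y) ν(dy) / ν(ℝ^d)` of the normalized measure, where `η_n` is a mollifier of
width `1/(n+1)`. -/
def IsAverage (P : Measure Ω) (h : Ω → (𝓢(E d, ℝ) →L[ℝ] ℝ)) (ν : Measure (E d))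
    (X : Ω → ℝ) : Prop :=
  MemLp X 2 P ∧ ∃ f : ℕ → 𝓢(E d, ℝ),
    (∀ n x, f n x = ⨍ y, (bump d n).normed volume (x - y) ∂ν) ∧
    Tendsto (fun n => eLpNorm (fun ω => h ω (f n) - X ω) 2 P) atTop (𝓝 0)

/-- Surface measure on the unit sphere of `ℝ^d`, as a measure on `ℝ^d`. -/
noncomputable def sphereMeasure (d : ℕ) : Measure (E d) :=
  ((volume : Measure (E d)).toSphere).map Subtype.val

/-- Lebesgue measure on the box `x + [-ε, ε]^d`. -/
noncomputable def boxMeasure (ε : ℝ) (x : E d) : Measure (E d) :=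
  volume.restrict {y : E d | ∀ i, |y i - x i| ≤ ε}

/-- `h` is a whole-space log-correlated Gaussian field on `ℝ^d`, normalized so that its average
over the unit sphere is zero: a random tempered distribution which is a centered Gaussian process
on Schwartz functions of integral zero, with covariance kernel `log (1 / |x - y|)`. -/
structure IsLGF (P : Measure Ω) (h : Ω → (𝓢(E d, ℝ) →L[ℝ] ℝ)) : Prop where
  measurable : ∀ f : 𝓢(E d, ℝ), Measurable (fun ω => h ω f)
  gaussian : IsGaussianProcess
    (fun (f : {f : 𝓢(E d, ℝ) // ∫ x, f x = 0}) (ω : Ω) => h ω f.1) P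
  centered : ∀ f : 𝓢(E d, ℝ), ∫ x, f x = 0 → ∫ ω, h ω f ∂P = 0
  covariance : ∀ f₁ f₂ : 𝓢(E d, ℝ), ∫ x, f₁ x = 0 → ∫ x, f₂ x = 0 →
    cov[fun ω => h ω f₁, fun ω => h ω f₂; P] =
      ∫ p : E d × E d, f₁ p.1 * f₂ p.2 * Real.log (1 / ‖p.1 - p.2‖)
  normalized : IsAverage P h (sphereMeasure d) (fun _ => 0)

open Classical in
/-- The mollified field `h_ε(x)`: the average of `h` over the box `x + [-ε, ε]^d` (an `L²` limit,
hence determined up to almost sure equality). -/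
noncomputable def boxAverage (P : Measure Ω) (h : Ω → (𝓢(E d, ℝ) →L[ℝ] ℝ)) (ε : ℝ) (x : E d) :
    Ω → ℝ :=
  if H : ∃ X : Ω → ℝ, IsAverage P h (boxMeasure ε x) X then H.choose else 0

end Field

/-! ### First passage percolation on the rescaled lattice

The vertices of `ε ℤ^d` are written `ε z` with `z : Fin d → ℤ`, and a vertex weight is a
function of `z`. -/

section Metric

variable {d : ℕ}

/-- The point `ε z` of `ε ℤ^d`. -/
noncomputable def latticePoint (ε : ℝ) (z : Fin d → ℤ) : E d :=
  WithLp.toLp 2 (fun i => ε * (z i : ℝ))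

/-- Nearest neighbours in the lattice. -/
def Adj (z w : Fin d → ℤ) : Prop := ∑ i, |z i - w i| = 1

/-- `P` is a nearest-neighbour path with `N + 1` vertices from `z` to `w`, staying in `A`. -/
structure IsPath (A : Set (Fin d → ℤ)) (z w : Fin d → ℤ) (N : ℕ)
    (P : Fin (N + 1) → (Fin d → ℤ)) : Prop where
  start : P 0 = z
  finish : P (Fin.last N) = w
  step : ∀ i : Fin N, Adj (P i.castSucc) (P i.succ)
  mem : ∀ i, P i ∈ A

/-- The length `∑ ε e^{ξ φ(P i)}` of a path, where `φ z` is the value of the field at `ε z`. -/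
noncomputable def pathLength (ε ξ : ℝ) (φ : (Fin d → ℤ) → ℝ) {N : ℕ}
    (P : Fin (N + 1) → (Fin d → ℤ)) : ℝ :=
  ∑ i, ε * Real.exp (ξ * φ (P i))

/-- The distance between two vertices restricted to `A`; it is `∞` if no path in `A` joins
them. -/
noncomputable def dist (ε ξ : ℝ) (φ : (Fin d → ℤ) → ℝ) (A : Set (Fin d → ℤ))
    (z w : Fin d → ℤ) : ℝ≥0∞ :=
  ⨅ (N : ℕ) (P : Fin (N + 1) → (Fin d → ℤ)) (_ : IsPath A z w N P),
    ENNReal.ofReal (pathLength ε ξ φ P)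

/-- The set-to-set distance restricted to `A`. -/
noncomputable def setDist (ε ξ : ℝ) (φ : (Fin d → ℤ) → ℝ) (A B C : Set (Fin d → ℤ)) : ℝ≥0∞ :=
  ⨅ z ∈ B, ⨅ w ∈ C, dist ε ξ φ A z w

/-- The lattice cube `[0,1]^d ∩ ε ℤ^d`. -/
def cube (d : ℕ) (ε : ℝ) : Set (Fin d → ℤ) :=
  {z | ∀ i, latticePoint ε z i ∈ Set.Icc (0 : ℝ) 1}

/-- The face of the lattice cube on which the first coordinate equals `a`: the left boundary
for `a = 0` and the right boundary for `a = 1`. -/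
def face (d : ℕ) (ε a : ℝ) : Set (Fin d → ℤ) :=
  {z | z ∈ cube d ε ∧ ∀ i : Fin d, (i : ℕ) = 0 → latticePoint ε z i = a}

end Metric

/-- The left-right crossing distance of the unit cube for the metric at scale `ε`. -/
noncomputable def crossingDist {Ω : Type*} [MeasurableSpace Ω] {d : ℕ} (P : Measure Ω)
    (h : Ω → (𝓢(E d, ℝ) →L[ℝ] ℝ)) (ε ξ : ℝ) (ω : Ω) : ℝ≥0∞ :=
  setDist ε ξ (fun z => boxAverage P h ε (latticePoint ε z) ω)
    (cube d ε) (face d ε 0) (face d ε 1)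

/-- The set-to-set distance exponent `λ(d, ξ)` of the field `h`: the supremum, in the extended
reals, of the `α` for which the crossing distance is at most `ε^α` with probability tending to one
as `ε → 0`. The limit is taken along `ε = 1/(n+1)`, since the right boundary
`({1} × [0,1]^{d-1}) ∩ ε ℤ^d` is empty unless `1/ε` is an integer. -/
noncomputable def exponent {Ω : Type*} [MeasurableSpace Ω] {d : ℕ} (P : Measure Ω)
    (h : Ω → (𝓢(E d, ℝ) →L[ℝ] ℝ)) (ξ : ℝ) : EReal :=
  sSup ((fun α : ℝ => (α : EReal)) '' {α : ℝ |
    liminf (fun n : ℕ => P {ω | crossingDist P h (1 / ((n : ℝ) + 1)) ξ ω ≤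
      ENNReal.ofReal ((1 / ((n : ℝ) + 1)) ^ α)}) atTop = 1})

end LFPP

/-! The proof compares the `d`-dimensional field with the section of the `(d + k)`-dimensional field
where the last `k` coordinates vanish. A lattice path in the section is also a path in the larger
cube, so crossing the larger cube costs at most as much as crossing the section
(`setDist_cube_extend_le`). It remains to see that the section and the `d`-dimensional field give
the same crossing distance up to a factor `ε ^ (-o(1))`, with probability tending to one.

By Frullani, `log (1 / r)` is half the integral of `t⁻¹ * (exp (-t r²) - exp (-t))` over `t > 0`,
and the second term disappears when tested against functions of integral zero. Gaussian kernels
factor over coordinates, so passing from dimension `d` to the section multiplies the box-averaged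
kernel at each `t` by `g ^ k`, where `g = segKernel ε 0 ε 0 t` lies in `[0, 1]`. The covariance lost
is therefore an integral of positive semidefinite kernels with weights `t⁻¹ * (1 - g ^ k) ≥ 0`. Its
entries are bounded uniformly in `ε`: `1 - g ^ k` controls `t ≤ ε⁻²`, and the decay of the box
kernel controls `t > ε⁻²` (`lossCov_bound`). Hence, modulo additive constants, the `d`-dimensional
field has the law of the section plus an independent Gaussian vector of bounded variances
(`map_subCoord_fieldVec`).

A union bound over the polynomially many lattice points makes this vector at most `δ log (1/ε)`
everywhere (`tendsto_lossMeasure`). The constants are fixed by subtracting the value at the origin,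
whose second moment is `O(log (1/ε))`, so Chebyshev makes it negligible as well
(`tendsto_measure_origin`). In `measure_crossingDist_le` these errors change the exponent by `4 δ`,
and `δ > 0` is arbitrary. -/

namespace LFPP

section Energy

variable {d : ℕ}

/-! ### The logarithmic energy of bounded compactly supported functions -/

/-- `F` is measurable, bounded by `M` and vanishes outside the ball of radius `R`. -/
structure BddSupp (M R : ℝ) (F : E d → ℝ) : Prop where
  meas : Measurable F
  bound : ∀ x, |F x| ≤ M
  supp : ∀ x, R < ‖x‖ → F x = 0

/-- The logarithmic kernel restricted to pairs of points of the ball of radius `R`. -/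
noncomputable def truncLog (d : ℕ) (R : ℝ) : E d × E d → ℝ :=
  (Metric.closedBall 0 R ×ˢ Metric.closedBall 0 R).indicator
    (fun p => Real.log (1 / ‖p.1 - p.2‖))

lemma measurable_logKernel :
    Measurable (fun p : E d × E d => Real.log (1 / ‖p.1 - p.2‖)) := by
  fun_prop

/-- In polar coordinates this is the integrability of `r ^ (d - 1) * log r` near zero. -/
lemma integrableOn_log_norm (hd : 1 ≤ d) (R : ℝ) :
    IntegrableOn (fun x : E d => Real.log ‖x‖) (Metric.ball 0 R) := by
  rcases le_or_gt R 0 with hR | hR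
  · simp [Metric.ball_eq_empty.2 hR]
  have : Nontrivial (E d) := by
    have : Nonempty (Fin d) := ⟨⟨0, by omega⟩⟩
    infer_instance
  rw [integrableOn_fun_norm_addHaar]
  have h1 : IntervalIntegrable (fun y : ℝ => y ^ (Module.finrank ℝ (E d) - 1) • Real.log y)
      volume 0 R :=
    intervalIntegral.intervalIntegrable_log'.continuousOn_mul (by fun_prop)
  exact ((intervalIntegrable_iff_integrableOn_Ioc_of_le hR.le).1 h1).mono_set
    Set.Ioo_subset_Ioc_self

/-- Differences of points of the ball lie in the ball of radius `2 * R + 1`, so the kernel is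
dominated by the integrand of a convolution of two integrable functions. -/
lemma integrable_truncLog (hd : 1 ≤ d) (R : ℝ) : Integrable (truncLog d R) := by
  have h1 : Integrable (fun x : E d => (Metric.ball (0 : E d) (2 * R + 1)).indicator
      (fun x => Real.log ‖x‖) x) :=
    (integrable_indicator_iff Metric.isOpen_ball.measurableSet).2 (integrableOn_log_norm hd _)
  have h2 : Integrable (fun x : E d => (Metric.closedBall (0 : E d) R).indicator
      (fun _ => (1 : ℝ)) x) :=
    (integrable_indicator_iff Metric.isClosed_closedBall.measurableSet).2
      (integrableOn_const (measure_closedBall_lt_top).ne)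
  have h3 := h2.convolution_integrand (ContinuousLinearMap.mul ℝ ℝ) h1
  refine h3.mono ?_ (ae_of_all _ fun p => ?_)
  · exact (measurable_logKernel.indicator (Metric.isClosed_closedBall.measurableSet.prod
      Metric.isClosed_closedBall.measurableSet)).aestronglyMeasurable
  · unfold truncLog
    by_cases hp : p ∈ Metric.closedBall (0 : E d) R ×ˢ Metric.closedBall (0 : E d) R
    · have hp' : p.1 - p.2 ∈ Metric.ball (0 : E d) (2 * R + 1) := by
        have h4 := mem_closedBall_zero_iff.1 hp.1
        have h5 := mem_closedBall_zero_iff.1 hp.2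
        have h6 := norm_sub_le p.1 p.2
        rw [mem_ball_zero_iff]
        linarith
      rw [Set.indicator_of_mem hp, Set.indicator_of_mem hp', Set.indicator_of_mem hp.2]
      simp
    · rw [Set.indicator_of_notMem hp, norm_zero]
      exact norm_nonneg _

/-- The energy `∬ F(x) F(y) log (1/|x - y|) dx dy`. -/
noncomputable def logEnergy (F : E d → ℝ) : ℝ :=
  ∫ p : E d × E d, F p.1 * F p.2 * Real.log (1 / ‖p.1 - p.2‖)

lemma BddSupp.norm_mul_log_le {M R : ℝ} {F : E d → ℝ} (hF : BddSupp M R F) (p : E d × E d) :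
    ‖F p.1 * F p.2 * Real.log (1 / ‖p.1 - p.2‖)‖ ≤ M ^ 2 * ‖truncLog d R p‖ := by
  unfold truncLog
  by_cases hp : p ∈ Metric.closedBall (0 : E d) R ×ˢ Metric.closedBall (0 : E d) R
  · rw [Set.indicator_of_mem hp, norm_mul]
    refine mul_le_mul_of_nonneg_right ?_ (norm_nonneg _)
    rw [norm_mul, sq]
    exact mul_le_mul (hF.bound _) (hF.bound _) (norm_nonneg _)
      ((abs_nonneg _).trans (hF.bound p.1))
  · rw [Set.indicator_of_notMem hp]
    have : F p.1 * F p.2 = 0 := by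
      by_contra h
      refine hp ⟨?_, ?_⟩ <;> rw [mem_closedBall_zero_iff] <;> by_contra! h'
      · exact h (by rw [hF.supp _ h', zero_mul])
      · exact h (by rw [hF.supp _ h', mul_zero])
    simp [this]

lemma BddSupp.integrable_mul_log (hd : 1 ≤ d) {M R : ℝ} {F : E d → ℝ} (hF : BddSupp M R F) :
    Integrable (fun p : E d × E d => F p.1 * F p.2 * Real.log (1 / ‖p.1 - p.2‖)) := by
  refine ((integrable_truncLog hd R).norm.const_mul (M ^ 2)).mono' ?_
    (ae_of_all _ hF.norm_mul_log_le)
  have h1 : Measurable (fun p : E d × E d => F p.1) := hF.meas.comp measurable_fst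
  have h2 : Measurable (fun p : E d × E d => F p.2) := hF.meas.comp measurable_snd
  exact ((h1.mul h2).mul measurable_logKernel).aestronglyMeasurable

/-- The energy is continuous under bounded almost everywhere convergence. -/
lemma tendsto_logEnergy (hd : 1 ≤ d) {ι : Type*} {l : Filter ι} [l.IsCountablyGenerated]
    {M R : ℝ} {F : ι → E d → ℝ} {G : E d → ℝ} (hF : ∀ i, BddSupp M R (F i))
    (hlim : ∀ᵐ x, Tendsto (fun i => F i x) l (𝓝 (G x))) :
    Tendsto (fun i => logEnergy (F i)) l (𝓝 (logEnergy G)) := by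
  refine tendsto_integral_filter_of_dominated_convergence
    (fun p => M ^ 2 * ‖truncLog d R p‖)
    (Eventually.of_forall fun i => ((hF i).integrable_mul_log hd).aestronglyMeasurable)
    (Eventually.of_forall fun i => ae_of_all _ (hF i).norm_mul_log_le)
    ((integrable_truncLog hd R).norm.const_mul _) ?_
  have h1 := (Measure.quasiMeasurePreserving_fst (μ := (volume : Measure (E d)))
    (ν := (volume : Measure (E d)))).ae hlim
  have h2 := (Measure.quasiMeasurePreserving_snd (μ := (volume : Measure (E d)))
    (ν := (volume : Measure (E d)))).ae hlim
  filter_upwards [h1, h2] with p hp1 hp2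
  exact (hp1.mul hp2).mul_const _

/-! ### The Gaussian representation of the logarithm -/

lemma integrableOn_frullani_exp {a : ℝ} (ha : 0 < a) :
    IntegrableOn (fun t : ℝ => t⁻¹ * (Real.exp (-(a * t)) - Real.exp (-t))) (Set.Ioi 0) := by
  -- From `1 - exp (-b t) ≤ b t`: the factor `t⁻¹` is cancelled at zero and the slower exponential,
  -- of rate `m = min a 1`, remains at infinity.
  have key : ∀ m b t : ℝ, 0 ≤ b → 0 < t →
      0 ≤ t⁻¹ * (Real.exp (-(m * t)) - Real.exp (-((m + b) * t))) ∧
      t⁻¹ * (Real.exp (-(m * t)) - Real.exp (-((m + b) * t))) ≤ b * Real.exp (-m * t) := by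
    intro m b t hb ht
    have h1 : Real.exp (-((m + b) * t)) = Real.exp (-m * t) * Real.exp (-(b * t)) := by
      rw [← Real.exp_add]; ring_nf
    have h2 : Real.exp (-(b * t)) ≤ 1 := by
      rw [Real.exp_le_one_iff]; nlinarith
    have h3 := Real.add_one_le_exp (-(b * t))
    have h4 := Real.exp_pos (-m * t)
    rw [h1, ← neg_mul, ← mul_one_sub]
    refine ⟨by have := inv_pos.2 ht; have : 0 ≤ 1 - Real.exp (-(b * t)) := by linarith
               positivity, ?_⟩
    rw [inv_mul_le_iff₀ ht]
    nlinarith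
  have hm : 0 < min a 1 := lt_min ha one_pos
  refine Integrable.mono' ((exp_neg_integrableOn_Ioi 0 hm).const_mul |a - 1|)
    (Measurable.aestronglyMeasurable (by fun_prop)) ?_
  filter_upwards [ae_restrict_mem measurableSet_Ioi] with t ht
  rcases le_total a 1 with h | h
  · obtain ⟨h1, h2⟩ := key a (1 - a) t (by linarith) ht
    rw [add_sub_cancel, one_mul] at h1 h2
    rw [min_eq_left h, Real.norm_of_nonneg h1, abs_of_nonpos (by linarith), neg_sub]
    exact h2
  · obtain ⟨h1, h2⟩ := key 1 (a - 1) t (by linarith) ht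
    rw [add_sub_cancel, one_mul] at h1 h2
    rw [min_eq_right h, ← norm_neg, ← mul_neg, neg_sub, Real.norm_of_nonneg h1,
      abs_of_nonneg (by linarith)]
    exact h2

lemma integral_frullani_exp {a : ℝ} (ha : 0 < a) :
    ∫ t in Set.Ioi (0 : ℝ), t⁻¹ * (Real.exp (-(a * t)) - Real.exp (-t)) = Real.log (1 / a) := by
  have h := Frullani.integral_Ioi_eq (f := fun t : ℝ => Real.exp (-t)) (L := 1) (R := 0)
    ?_ ha one_pos ?_ ?_ ?_
  · simpa using h
  · exact (Continuous.locallyIntegrable (by fun_prop)).locallyIntegrableOn _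
  · have : Tendsto (fun t : ℝ => Real.exp (-t)) (𝓝 0) (𝓝 (Real.exp (-0))) :=
      Continuous.tendsto (by fun_prop) 0
    simp only [neg_zero, Real.exp_zero] at this
    exact this.mono_left nhdsWithin_le_nhds
  · exact Real.tendsto_exp_neg_atTop_nhds_zero
  · simpa using integrableOn_frullani_exp ha

/-- The integrand has constant sign, so absolute integrability in Fubini's theorem costs no more
than integrability against `|log|`. -/
lemma integral_norm_frullani_exp {a : ℝ} (ha : 0 < a) :
    ∫ t in Set.Ioi (0 : ℝ), ‖t⁻¹ * (Real.exp (-(a * t)) - Real.exp (-t))‖ =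
      |Real.log (1 / a)| := by
  rw [← integral_frullani_exp ha]
  rcases le_total a 1 with h | h
  · have h1 : ∀ t ∈ Set.Ioi (0 : ℝ), 0 ≤ t⁻¹ * (Real.exp (-(a * t)) - Real.exp (-t)) := by
      intro t ht
      have ht' : 0 < t := ht
      have : Real.exp (-t) ≤ Real.exp (-(a * t)) := Real.exp_le_exp.2 (by nlinarith)
      exact mul_nonneg (inv_pos.2 ht').le (by linarith)
    rw [abs_of_nonneg (setIntegral_nonneg measurableSet_Ioi h1)]
    exact setIntegral_congr_fun measurableSet_Ioi fun t ht => Real.norm_of_nonneg (h1 t ht)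
  · have h1 : ∀ t ∈ Set.Ioi (0 : ℝ), t⁻¹ * (Real.exp (-(a * t)) - Real.exp (-t)) ≤ 0 := by
      intro t ht
      have ht' : 0 < t := ht
      have : Real.exp (-(a * t)) ≤ Real.exp (-t) := Real.exp_le_exp.2 (by nlinarith)
      exact mul_nonpos_of_nonneg_of_nonpos (inv_pos.2 ht').le (by linarith)
    rw [abs_of_nonpos (setIntegral_nonpos measurableSet_Ioi h1), ← integral_neg]
    exact setIntegral_congr_fun measurableSet_Ioi fun t ht => Real.norm_of_nonpos (h1 t ht)

/-- The energy of `F` for the kernel `exp (-t |x - y|²)`. -/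
noncomputable def gaussEnergy (t : ℝ) (F : E d → ℝ) : ℝ :=
  ∫ p : E d × E d, F p.1 * F p.2 * Real.exp (-(t * ‖p.1 - p.2‖ ^ 2))

lemma BddSupp.integrable {M R : ℝ} {F : E d → ℝ} (hF : BddSupp M R F) : Integrable F := by
  refine ((integrable_indicator_iff Metric.isClosed_closedBall.measurableSet).2
      (integrableOn_const (C := M) (measure_closedBall_lt_top (x := (0 : E d)) (r := R)).ne)).mono'
      hF.meas.aestronglyMeasurable (ae_of_all _ fun x => ?_)
  by_cases hx : x ∈ Metric.closedBall (0 : E d) R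
  · rw [Set.indicator_of_mem hx]
    exact hF.bound x
  · rw [Set.indicator_of_notMem hx, hF.supp x (by simpa using hx), norm_zero]

lemma BddSupp.integrable_mul {M R : ℝ} {F : E d → ℝ} (hF : BddSupp M R F) :
    Integrable (fun p : E d × E d => F p.1 * F p.2) :=
  hF.integrable.mul_prod hF.integrable

lemma ae_fst_ne_snd (hd : 1 ≤ d) : ∀ᵐ p : E d × E d, p.1 ≠ p.2 := by
  have : Nonempty (Fin d) := ⟨⟨0, by omega⟩⟩
  have hm : MeasurableSet {p : E d × E d | p.1 ≠ p.2} :=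
    (measurableSet_eq_fun measurable_fst measurable_snd).compl
  rw [Measure.volume_eq_prod, Measure.ae_prod_iff_ae_ae hm]
  refine ae_of_all _ fun x => ?_
  filter_upwards [compl_mem_ae_iff.2 (measure_singleton x)] with y hy h
  exact hy h.symm

lemma integrable_mul_frullani (hd : 1 ≤ d) {M R : ℝ} {F : E d → ℝ} (hF : BddSupp M R F) :
    Integrable (fun q : (E d × E d) × ℝ => F q.1.1 * F q.1.2 *
      (q.2⁻¹ * (Real.exp (-(‖q.1.1 - q.1.2‖ ^ 2 * q.2)) - Real.exp (-q.2))))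
      ((volume : Measure (E d × E d)).prod (volume.restrict (Set.Ioi 0))) := by
  have hmeas : Measurable (fun q : (E d × E d) × ℝ => F q.1.1 * F q.1.2 *
      (q.2⁻¹ * (Real.exp (-(‖q.1.1 - q.1.2‖ ^ 2 * q.2)) - Real.exp (-q.2)))) := by
    have h1 : Measurable (fun q : (E d × E d) × ℝ => F q.1.1) :=
      hF.meas.comp (measurable_fst.comp measurable_fst)
    have h2 : Measurable (fun q : (E d × E d) × ℝ => F q.1.2) :=
      hF.meas.comp (measurable_snd.comp measurable_fst)
    exact (h1.mul h2).mul (by fun_prop)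
  rw [integrable_prod_iff hmeas.aestronglyMeasurable]
  constructor
  · filter_upwards [ae_fst_ne_snd hd] with p hp
    have hr : 0 < ‖p.1 - p.2‖ := norm_pos_iff.2 (sub_ne_zero.2 hp)
    exact (integrableOn_frullani_exp (by positivity)).const_mul _
  · refine (((hF.integrable_mul_log hd).norm).const_mul 2).congr ?_
    filter_upwards [ae_fst_ne_snd hd] with p hp
    have hr : 0 < ‖p.1 - p.2‖ := norm_pos_iff.2 (sub_ne_zero.2 hp)
    simp only [norm_mul (F p.1 * F p.2)]
    rw [integral_const_mul, integral_norm_frullani_exp (by positivity), one_div, one_div,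
      Real.log_inv, Real.log_inv, Real.log_pow, abs_neg, abs_mul, norm_neg, Real.norm_eq_abs]
    simp
    ring

lemma BddSupp.integrable_gauss {M R : ℝ} {F : E d → ℝ} (hF : BddSupp M R F) {t : ℝ}
    (ht : 0 ≤ t) :
    Integrable (fun p : E d × E d => F p.1 * F p.2 * Real.exp (-(t * ‖p.1 - p.2‖ ^ 2))) := by
  refine hF.integrable_mul.mul_bdd (c := 1) (Continuous.aestronglyMeasurable (by fun_prop))
    (ae_of_all _ fun p => ?_)
  rw [Real.norm_eq_abs, Real.abs_exp, Real.exp_le_one_iff]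
  have := mul_nonneg ht (sq_nonneg ‖p.1 - p.2‖)
  linarith

/-- The term `exp (-t)` does not depend on the two points, so it is multiplied by the square of the
integral of `F`, which is zero. -/
lemma integral_mul_frullani {M R : ℝ} {F : E d → ℝ} (hF : BddSupp M R F)
    (hF0 : ∫ x, F x = 0) {t : ℝ} (ht : 0 < t) :
    ∫ p : E d × E d, F p.1 * F p.2 *
      (t⁻¹ * (Real.exp (-(‖p.1 - p.2‖ ^ 2 * t)) - Real.exp (-t))) = t⁻¹ * gaussEnergy t F := by
  have h0 : ∫ p : E d × E d, F p.1 * F p.2 = 0 := by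
    rw [Measure.volume_eq_prod, integral_prod_mul, hF0, zero_mul]
  have h1 : ∀ p : E d × E d, F p.1 * F p.2 *
      (t⁻¹ * (Real.exp (-(‖p.1 - p.2‖ ^ 2 * t)) - Real.exp (-t))) =
      t⁻¹ * (F p.1 * F p.2 * Real.exp (-(t * ‖p.1 - p.2‖ ^ 2))) -
        t⁻¹ * Real.exp (-t) * (F p.1 * F p.2) := fun p => by
    rw [mul_comm (‖p.1 - p.2‖ ^ 2) t]; ring
  simp_rw [h1]
  rw [integral_sub ((hF.integrable_gauss ht.le).const_mul _) (hF.integrable_mul.const_mul _),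
    integral_const_mul, integral_const_mul, h0, mul_zero, sub_zero, gaussEnergy]

lemma integrableOn_gaussEnergy (hd : 1 ≤ d) {M R : ℝ} {F : E d → ℝ} (hF : BddSupp M R F)
    (hF0 : ∫ x, F x = 0) :
    IntegrableOn (fun t => t⁻¹ * gaussEnergy t F) (Set.Ioi 0) := by
  refine (integrable_mul_frullani hd hF).integral_prod_right.congr ?_
  filter_upwards [ae_restrict_mem measurableSet_Ioi] with t ht
  exact integral_mul_frullani hF hF0 ht

lemma logEnergy_eq (hd : 1 ≤ d) {M R : ℝ} {F : E d → ℝ} (hF : BddSupp M R F)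
    (hF0 : ∫ x, F x = 0) :
    logEnergy F = 1 / 2 * ∫ t in Set.Ioi (0 : ℝ), t⁻¹ * gaussEnergy t F := by
  have h1 : ∫ t in Set.Ioi (0 : ℝ), t⁻¹ * gaussEnergy t F =
      ∫ t in Set.Ioi (0 : ℝ), ∫ p : E d × E d, F p.1 * F p.2 *
      (t⁻¹ * (Real.exp (-(‖p.1 - p.2‖ ^ 2 * t)) - Real.exp (-t))) :=
    setIntegral_congr_fun measurableSet_Ioi fun t ht => (integral_mul_frullani hF hF0 ht).symm
  rw [h1, ← integral_integral_swap (integrable_mul_frullani hd hF), ← integral_const_mul, logEnergy]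
  refine integral_congr_ae ?_
  filter_upwards [ae_fst_ne_snd hd] with p hp
  have hr : 0 < ‖p.1 - p.2‖ := norm_pos_iff.2 (sub_ne_zero.2 hp)
  rw [integral_const_mul, integral_frullani_exp (by positivity)]
  rw [one_div, one_div, one_div, Real.log_inv, Real.log_inv, Real.log_pow]
  push_cast
  ring

/-! ### Positivity of the Gaussian kernel -/

/-- Up to a positive constant, `exp (-t |x - y|²)` is the integral over `z` of `exp (-2t |x - z|²) *
exp (-2t |y - z|²)`. After Fubini the energy is an integral over `z` of squares. -/
lemma gaussEnergy_nonneg {M R : ℝ} {F : E d → ℝ} (hF : BddSupp M R F) {t : ℝ} (ht : 0 < t) :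
    0 ≤ gaussEnergy t F := by
  have hpos : 0 < ∫ z : E d, Real.exp (-(4 * t) * ‖z‖ ^ 2) := by
    rw [GaussianFourier.integral_rexp_neg_mul_sq_norm (by positivity)]
    positivity
  have hint : Integrable (fun z : E d => Real.exp (-(4 * t) * ‖z‖ ^ 2)) :=
    Integrable.of_integral_ne_zero hpos.ne'
  set Φ : (E d × E d) × E d → ℝ := fun q => F q.1.1 * F q.1.2 *
    (Real.exp (-(2 * t) * ‖q.1.1 - q.2‖ ^ 2) * Real.exp (-(2 * t) * ‖q.1.2 - q.2‖ ^ 2)) with hΦ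
  have hkey : ∀ p : E d × E d, ∀ z, Φ (p, z) =
      F p.1 * F p.2 * Real.exp (-(t * ‖p.1 - p.2‖ ^ 2)) *
        Real.exp (-(4 * t) * ‖z - (1 / 2 : ℝ) • (p.1 + p.2)‖ ^ 2) := by
    intro p z
    simp only [hΦ]
    rw [mul_assoc (F p.1 * F p.2), ← Real.exp_add, ← Real.exp_add]
    congr 2
    -- The parallelogram law splits the exponent into the distance between the two points and the
    -- distance from `z` to their midpoint.
    have h1 := parallelogram_law_with_norm ℝ (p.1 - z) (p.2 - z)
    have h2 : (p.1 - z) + (p.2 - z) = (-2 : ℝ) • (z - (1 / 2 : ℝ) • (p.1 + p.2)) := by module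
    have h3 : (p.1 - z) - (p.2 - z) = p.1 - p.2 := by abel
    rw [h2, h3, norm_smul] at h1
    rw [show ‖(-2 : ℝ)‖ = 2 by norm_num] at h1
    linear_combination t * h1
  have hmeas : Measurable Φ := by
    have h1 : Measurable (fun q : (E d × E d) × E d => F q.1.1) :=
      hF.meas.comp (measurable_fst.comp measurable_fst)
    have h2 : Measurable (fun q : (E d × E d) × E d => F q.1.2) :=
      hF.meas.comp (measurable_snd.comp measurable_fst)
    exact (h1.mul h2).mul (by fun_prop)
  have hΦint : Integrable Φ ((volume : Measure (E d × E d)).prod volume) := by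
    rw [integrable_prod_iff hmeas.aestronglyMeasurable]
    refine ⟨ae_of_all _ fun p => ?_, ?_⟩
    · simp_rw [hkey]
      exact (hint.comp_sub_right _).const_mul _
    · refine ((hF.integrable_gauss ht.le).norm.mul_const
        (∫ z : E d, Real.exp (-(4 * t) * ‖z‖ ^ 2))).congr (ae_of_all _ fun p => ?_)
      simp_rw [hkey, norm_mul _ (Real.exp (-(4 * t) * _)), Real.norm_eq_abs (Real.exp _),
        Real.abs_exp]
      rw [integral_const_mul,
        integral_sub_right_eq_self (fun z : E d => Real.exp (-(4 * t) * ‖z‖ ^ 2))]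
  have h1 : ∫ p : E d × E d, ∫ z, Φ (p, z) =
      gaussEnergy t F * ∫ z : E d, Real.exp (-(4 * t) * ‖z‖ ^ 2) := by
    rw [gaussEnergy, ← integral_mul_const]
    refine integral_congr_ae (ae_of_all _ fun p => ?_)
    simp_rw [hkey]
    rw [integral_const_mul,
      integral_sub_right_eq_self (fun z : E d => Real.exp (-(4 * t) * ‖z‖ ^ 2))]
  have h2 : ∫ p : E d × E d, ∫ z, Φ (p, z) = ∫ z, ∫ p : E d × E d, Φ (p, z) :=
    integral_integral_swap hΦint
  have h3 : 0 ≤ ∫ z, ∫ p : E d × E d, Φ (p, z) := by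
    refine integral_nonneg fun z => ?_
    have h4 : ∫ p : E d × E d, Φ (p, z) =
        (∫ x, F x * Real.exp (-(2 * t) * ‖x - z‖ ^ 2)) *
          ∫ x, F x * Real.exp (-(2 * t) * ‖x - z‖ ^ 2) := by
      rw [← integral_prod_mul, Measure.volume_eq_prod]
      refine integral_congr_ae (ae_of_all _ fun p => ?_)
      simp only [hΦ]
      ring
    simp only [Pi.zero_apply]
    rw [h4]
    exact mul_self_nonneg _
  rw [← h2, h1] at h3
  exact nonneg_of_mul_nonneg_left h3 hpos

lemma BddSupp.sum {J : Type*} [Fintype J] {M R : J → ℝ} (hR : ∀ j, 0 ≤ R j) {F : J → E d → ℝ}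
    (hF : ∀ j, BddSupp (M j) (R j) (F j)) (c : J → ℝ) :
    BddSupp (∑ j, |c j| * M j) (∑ j, R j) (fun x => ∑ j, c j * F j x) where
  meas := Finset.measurable_fun_sum _ fun j _ => (hF j).meas.const_mul _
  bound x := by
    refine (Finset.abs_sum_le_sum_abs _ _).trans (Finset.sum_le_sum fun j _ => ?_)
    rw [abs_mul]
    exact mul_le_mul_of_nonneg_left ((hF j).bound x) (abs_nonneg _)
  supp x hx := by
    refine Finset.sum_eq_zero fun j _ => ?_
    rw [(hF j).supp x, mul_zero]
    exact (Finset.single_le_sum (fun i _ => hR i) (Finset.mem_univ j)).trans_lt hx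

/-! ### Uniform densities on segments and boxes -/

/-- The uniform probability density on `[a - ε, a + ε]`. -/
noncomputable def segDensity (ε a : ℝ) : ℝ → ℝ :=
  (Set.Icc (a - ε) (a + ε)).indicator (fun _ => (2 * ε)⁻¹)

lemma measurable_segDensity (ε a : ℝ) : Measurable (segDensity ε a) :=
  measurable_const.indicator measurableSet_Icc

lemma segDensity_nonneg {ε : ℝ} (hε : 0 < ε) (a u : ℝ) : 0 ≤ segDensity ε a u :=
  Set.indicator_nonneg (fun _ _ => by positivity) u

lemma segDensity_le {ε : ℝ} (hε : 0 < ε) (a u : ℝ) : segDensity ε a u ≤ (2 * ε)⁻¹ :=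
  Set.indicator_le_self' (fun _ _ => by positivity) u

lemma integrable_segDensity (ε a : ℝ) : Integrable (segDensity ε a) :=
  (integrable_indicator_iff measurableSet_Icc).2 (integrableOn_const (by simp))

lemma integral_segDensity {ε : ℝ} (hε : 0 < ε) (a : ℝ) : ∫ u, segDensity ε a u = 1 := by
  rw [segDensity, integral_indicator measurableSet_Icc, setIntegral_const]
  simp only [measureReal_def, Real.volume_Icc, smul_eq_mul]
  rw [ENNReal.toReal_ofReal (by linarith)]
  field_simp
  ring

lemma abs_sub_le_of_segDensity_ne_zero {ε a u : ℝ} (h : segDensity ε a u ≠ 0) : |u - a| ≤ ε := by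
  have := Set.mem_of_indicator_ne_zero h
  rw [abs_le]
  constructor <;> linarith [this.1, this.2]

lemma integrable_segDensity_mul (ε a : ℝ) {f : ℝ → ℝ} (hf : Measurable f) {C : ℝ}
    (hC : ∀ u, |f u| ≤ C) : Integrable (fun u => segDensity ε a u * f u) :=
  (integrable_segDensity ε a).mul_bdd (c := C) hf.aestronglyMeasurable (ae_of_all _ hC)

lemma integral_segDensity_mul_le {ε : ℝ} (hε : 0 < ε) (a : ℝ) {f : ℝ → ℝ} {C : ℝ}
    (hf0 : ∀ u, 0 ≤ f u) (hC : ∀ u, f u ≤ C) : ∫ u, segDensity ε a u * f u ≤ C := by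
  calc ∫ u, segDensity ε a u * f u ≤ ∫ u, segDensity ε a u * C :=
        integral_mono_of_nonneg
          (ae_of_all _ fun u => mul_nonneg (segDensity_nonneg hε a u) (hf0 u))
          ((integrable_segDensity ε a).mul_const C)
          (ae_of_all _ fun u => mul_le_mul_of_nonneg_left (hC u) (segDensity_nonneg hε a u))
    _ = C := by rw [integral_mul_const, integral_segDensity hε, one_mul]

lemma le_integral_segDensity_mul {ε : ℝ} (hε : 0 < ε) (a : ℝ) {f : ℝ → ℝ} {c C : ℝ}
    (hf : Measurable f) (hC : ∀ u, |f u| ≤ C) (hc : ∀ u, |u - a| ≤ ε → c ≤ f u) :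
    c ≤ ∫ u, segDensity ε a u * f u := by
  calc c = ∫ u, segDensity ε a u * c := by
        rw [integral_mul_const, integral_segDensity hε, one_mul]
    _ ≤ ∫ u, segDensity ε a u * f u := by
        refine integral_mono ((integrable_segDensity ε a).mul_const c)
          (integrable_segDensity_mul ε a hf hC) fun u => ?_
        by_cases h : segDensity ε a u = 0
        · simp [h]
        · exact mul_le_mul_of_nonneg_left (hc u (abs_sub_le_of_segDensity_ne_zero h))
            (segDensity_nonneg hε a u)

/-- The average of `exp (-t (u - v)²)` over `v ∈ [a - ε, a + ε]`. -/
noncomputable def segPotential (ε a t u : ℝ) : ℝ :=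
  ∫ v, segDensity ε a v * Real.exp (-(t * (u - v) ^ 2))

/-- The average of `exp (-t (u - v)²)` over `u ∈ [a - ε, a + ε]` and `v ∈ [a' - ε', a' + ε']`. -/
noncomputable def segKernel (ε a ε' a' t : ℝ) : ℝ :=
  ∫ u, segDensity ε a u * segPotential ε' a' t u

lemma measurable_segPotential (ε a : ℝ) :
    Measurable (fun q : ℝ × ℝ => segPotential ε a q.1 q.2) := by
  have h : Measurable (fun q : (ℝ × ℝ) × ℝ =>
      segDensity ε a q.2 * Real.exp (-(q.1.1 * (q.1.2 - q.2) ^ 2))) :=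
    ((measurable_segDensity ε a).comp measurable_snd).mul (by fun_prop)
  exact (h.stronglyMeasurable.integral_prod_right (ν := volume)).measurable

lemma measurable_segKernel (ε a ε' a' : ℝ) : Measurable (segKernel ε a ε' a') := by
  have h : Measurable (fun q : ℝ × ℝ => segDensity ε a q.2 * segPotential ε' a' q.1 q.2) :=
    ((measurable_segDensity ε a).comp measurable_snd).mul (measurable_segPotential ε' a')
  exact (h.stronglyMeasurable.integral_prod_right (ν := volume)).measurable

lemma segPotential_nonneg {ε : ℝ} (hε : 0 < ε) (a t u : ℝ) : 0 ≤ segPotential ε a t u :=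
  integral_nonneg fun v => mul_nonneg (segDensity_nonneg hε a v) (Real.exp_pos _).le

lemma exp_neg_mul_sq_le_one {t : ℝ} (ht : 0 ≤ t) (x : ℝ) : Real.exp (-(t * x ^ 2)) ≤ 1 := by
  rw [Real.exp_le_one_iff]
  have := mul_nonneg ht (sq_nonneg x)
  linarith

lemma segPotential_le_one {ε : ℝ} (hε : 0 < ε) (a : ℝ) {t : ℝ} (ht : 0 ≤ t) (u : ℝ) :
    segPotential ε a t u ≤ 1 :=
  integral_segDensity_mul_le hε a (fun _ => (Real.exp_pos _).le)
    fun _ => exp_neg_mul_sq_le_one ht _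

lemma segPotential_le_sqrt {ε : ℝ} (hε : 0 < ε) (a : ℝ) {t : ℝ} (ht : 0 < t) (u : ℝ) :
    segPotential ε a t u ≤ (2 * ε)⁻¹ * √(Real.pi / t) := by
  have h1 : Integrable (fun v : ℝ => Real.exp (-(t * (u - v) ^ 2))) := by
    simpa [neg_mul] using (integrable_exp_neg_mul_sq ht).comp_sub_left u
  have h2 : ∫ v : ℝ, Real.exp (-(t * (u - v) ^ 2)) = √(Real.pi / t) := by
    rw [← integral_gaussian, integral_sub_left_eq_self (fun v => Real.exp (-(t * v ^ 2)))]
    simp [neg_mul]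
  rw [← h2, ← integral_const_mul]
  exact integral_mono_of_nonneg
    (ae_of_all _ fun v => mul_nonneg (segDensity_nonneg hε a v) (Real.exp_pos _).le)
    (h1.const_mul _)
    (ae_of_all _ fun v => mul_le_mul_of_nonneg_right (segDensity_le hε a v) (Real.exp_pos _).le)

lemma segKernel_nonneg {ε ε' : ℝ} (hε : 0 < ε) (hε' : 0 < ε') (a a' t : ℝ) :
    0 ≤ segKernel ε a ε' a' t :=
  integral_nonneg fun v => mul_nonneg (segDensity_nonneg hε a v) (segPotential_nonneg hε' _ _ _)

lemma segKernel_le_one {ε ε' : ℝ} (hε : 0 < ε) (hε' : 0 < ε') (a a' : ℝ) {t : ℝ} (ht : 0 ≤ t) :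
    segKernel ε a ε' a' t ≤ 1 :=
  integral_segDensity_mul_le hε a (segPotential_nonneg hε' _ _) (segPotential_le_one hε' _ ht)

lemma segKernel_le_sqrt {ε ε' : ℝ} (hε : 0 < ε) (hε' : 0 < ε') (a a' : ℝ) {t : ℝ} (ht : 0 < t) :
    segKernel ε a ε' a' t ≤ (2 * ε')⁻¹ * √(Real.pi / t) :=
  integral_segDensity_mul_le hε a (segPotential_nonneg hε' _ _) (segPotential_le_sqrt hε' _ ht)

/-- Points of two concentric segments are at distance at most `ε + ε'`. -/
lemma le_segKernel {ε ε' : ℝ} (hε : 0 < ε) (hε' : 0 < ε') (a : ℝ) {t : ℝ} (ht : 0 ≤ t) :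
    Real.exp (-(t * (ε + ε') ^ 2)) ≤ segKernel ε a ε' a t := by
  refine le_integral_segDensity_mul hε a (C := 1)
    ((measurable_segPotential ε' a).comp (measurable_const.prodMk measurable_id)) (fun u => ?_)
    fun u hu => ?_
  · rw [abs_of_nonneg (segPotential_nonneg hε' _ _ _)]
    exact segPotential_le_one hε' _ ht _
  · refine le_integral_segDensity_mul hε' a (C := 1) (by fun_prop) (fun v => ?_) fun v hv => ?_
    · rw [Real.abs_exp]
      exact exp_neg_mul_sq_le_one ht _
    · have h1 : |u - v| ≤ ε + ε' := by
        calc |u - v| = |(u - a) - (v - a)| := by ring_nf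
          _ ≤ |u - a| + |v - a| := abs_sub _ _
          _ ≤ ε + ε' := add_le_add hu hv
      have h2 : (u - v) ^ 2 ≤ (ε + ε') ^ 2 := by
        rw [← sq_abs (u - v)]
        exact pow_le_pow_left₀ (abs_nonneg _) h1 2
      exact Real.exp_le_exp.2 (neg_le_neg (mul_le_mul_of_nonneg_left h2 ht))

/-- The uniform probability density on the box `x + [-ε, ε]^d`. -/
noncomputable def boxDensity (ε : ℝ) (x : E d) (y : E d) : ℝ := ∏ i, segDensity ε (x i) (y i)

/-- The average of `exp (-t |y - y'|²)` over two boxes. -/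
noncomputable def boxKernel (ε : ℝ) (x : E d) (ε' : ℝ) (x' : E d) (t : ℝ) : ℝ :=
  ∏ i, segKernel ε (x i) ε' (x' i) t

lemma boxDensity_eq_indicator (ε : ℝ) (x : E d) :
    boxDensity ε x = {y : E d | ∀ i, |y i - x i| ≤ ε}.indicator (fun _ => ((2 * ε) ^ d)⁻¹) := by
  ext y
  have h : ∀ i, (y i ∈ Set.Icc (x i - ε) (x i + ε) ↔ |y i - x i| ≤ ε) := fun i => by
    rw [abs_le, Set.mem_Icc]; constructor <;> rintro ⟨h1, h2⟩ <;> constructor <;> linarith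
  by_cases hy : y ∈ {y : E d | ∀ i, |y i - x i| ≤ ε}
  · rw [Set.indicator_of_mem hy, boxDensity]
    have : ∀ i, segDensity ε (x i) (y i) = (2 * ε)⁻¹ := fun i =>
      Set.indicator_of_mem ((h i).2 (hy i)) _
    simp only [this, Finset.prod_const, Finset.card_univ, Fintype.card_fin, inv_pow]
  · rw [Set.indicator_of_notMem hy]
    obtain ⟨i, hi⟩ := not_forall.1 hy
    exact Finset.prod_eq_zero (Finset.mem_univ i)
      (Set.indicator_of_notMem (fun hh => hi ((h i).1 hh)) _)

lemma integral_prod_coord (f : Fin d → ℝ → ℝ) :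
    ∫ x : E d, ∏ i, f i (x i) = ∏ i, ∫ u, f i u := by
  rw [← integral_fintype_prod_volume_eq_prod]
  exact (EuclideanSpace.volume_preserving_symm_measurableEquiv_toLp (Fin d)).integral_comp'
    (g := fun x : Fin d → ℝ => ∏ i, f i (x i))

lemma integral_boxDensity {ε : ℝ} (hε : 0 < ε) (x : E d) : ∫ y, boxDensity ε x y = 1 := by
  simp_rw [boxDensity, integral_prod_coord, integral_segDensity hε, Finset.prod_const_one]

lemma norm_le_of_coord_le {v : E d} {ε : ℝ} (hv : ∀ i, |v i| ≤ ε) : ‖v‖ ≤ √(d * ε ^ 2) := by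
  rw [EuclideanSpace.norm_eq]
  refine Real.sqrt_le_sqrt ?_
  calc ∑ i, ‖v i‖ ^ 2 ≤ ∑ _i : Fin d, ε ^ 2 :=
        Finset.sum_le_sum fun i _ => pow_le_pow_left₀ (norm_nonneg _) (hv i) 2
    _ = d * ε ^ 2 := by simp

/-- The radius of a ball around the origin that contains the box. -/
noncomputable def boxRadius (ε : ℝ) (x : E d) : ℝ := ‖x‖ + √(d * ε ^ 2)

lemma boxRadius_nonneg (ε : ℝ) (x : E d) : 0 ≤ boxRadius ε x := by
  unfold boxRadius; positivity

lemma boxDensity_eq_zero {ε : ℝ} {x y : E d} (h : boxRadius ε x < ‖y‖) : boxDensity ε x y = 0 := by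
  rw [boxDensity_eq_indicator]
  refine Set.indicator_of_notMem (fun hy => ?_) _
  have h1 : ‖y - x‖ ≤ √(d * ε ^ 2) := norm_le_of_coord_le hy
  have h2 : ‖y‖ ≤ ‖x‖ + ‖y - x‖ := by simpa using norm_add_le x (y - x)
  unfold boxRadius at h
  linarith

lemma measurable_boxDensity (ε : ℝ) (x : E d) : Measurable (boxDensity ε x) :=
  Finset.measurable_fun_prod _ fun i _ => (measurable_segDensity ε (x i)).comp (by fun_prop)

lemma boxDensity_nonneg {ε : ℝ} (hε : 0 < ε) (x y : E d) : 0 ≤ boxDensity ε x y :=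
  Finset.prod_nonneg fun _ _ => segDensity_nonneg hε _ _

lemma boxDensity_le {ε : ℝ} (hε : 0 < ε) (x y : E d) : boxDensity ε x y ≤ ((2 * ε) ^ d)⁻¹ := by
  rw [boxDensity_eq_indicator]
  exact Set.indicator_le_self' (fun _ _ => by positivity) y

lemma bddSupp_boxDensity {ε : ℝ} (hε : 0 < ε) (x : E d) :
    BddSupp ((2 * ε) ^ d)⁻¹ (boxRadius ε x) (boxDensity ε x) where
  meas := measurable_boxDensity ε x
  bound y := by
    rw [abs_of_nonneg (boxDensity_nonneg hε x y)]
    exact boxDensity_le hε x y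
  supp _ hy := boxDensity_eq_zero hy

/-- Both the box density and the Gaussian are products over coordinates. This factorization is what
makes different dimensions comparable. -/
lemma integral_boxDensity_mul_gauss {ε ε' : ℝ} (hε : 0 < ε) (hε' : 0 < ε') (x x' : E d) {t : ℝ}
    (ht : 0 ≤ t) :
    Integrable (fun p : E d × E d => boxDensity ε x p.1 * boxDensity ε' x' p.2 *
      Real.exp (-(t * ‖p.1 - p.2‖ ^ 2))) ∧
    ∫ p : E d × E d, boxDensity ε x p.1 * boxDensity ε' x' p.2 *
      Real.exp (-(t * ‖p.1 - p.2‖ ^ 2)) = boxKernel ε x ε' x' t := by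
  have hint : Integrable (fun p : E d × E d => boxDensity ε x p.1 * boxDensity ε' x' p.2 *
      Real.exp (-(t * ‖p.1 - p.2‖ ^ 2))) := by
    refine ((bddSupp_boxDensity hε x).integrable.mul_prod
      (bddSupp_boxDensity hε' x').integrable).mul_bdd (c := 1)
      (Continuous.aestronglyMeasurable (by fun_prop)) (ae_of_all _ fun p => ?_)
    rw [Real.norm_eq_abs, Real.abs_exp]
    exact exp_neg_mul_sq_le_one ht _
  refine ⟨hint, ?_⟩
  have h1 : ∀ y y' : E d, boxDensity ε x y * boxDensity ε' x' y' *
      Real.exp (-(t * ‖y - y'‖ ^ 2)) = ∏ i, segDensity ε (x i) (y i) *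
        (segDensity ε' (x' i) (y' i) * Real.exp (-(t * (y i - y' i) ^ 2))) := fun y y' => by
    rw [Finset.prod_mul_distrib, Finset.prod_mul_distrib, ← Real.exp_sum, EuclideanSpace.norm_sq_eq,
      mul_assoc, boxDensity, boxDensity]
    congr 3
    simp [Finset.mul_sum]
  have h2 : ∀ y : E d, ∫ y' : E d, boxDensity ε x y * boxDensity ε' x' y' *
      Real.exp (-(t * ‖y - y'‖ ^ 2)) =
      ∏ i, segDensity ε (x i) (y i) * segPotential ε' (x' i) t (y i) := fun y => by
    simp_rw [h1]
    rw [integral_prod_coord (fun i v => segDensity ε (x i) (y i) *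
      (segDensity ε' (x' i) v * Real.exp (-(t * (y i - v) ^ 2))))]
    simp_rw [integral_const_mul]
    rfl
  rw [Measure.volume_eq_prod, integral_prod _ hint, boxKernel]
  simp_rw [h2]
  exact integral_prod_coord (fun i u => segDensity ε (x i) u * segPotential ε' (x' i) t u)

/-! ### Energies of linear combinations of box densities. -/

section Combination

variable {J : Type*} [Fintype J] {ε : J → ℝ} (x : J → E d) (c : J → ℝ)

/-- The quadratic form `∑ c_j c_k K_t(j, k)` for the Gaussian kernel averaged over boxes. -/
noncomputable def boxForm (ε : J → ℝ) (x : J → E d) (c : J → ℝ) (t : ℝ) : ℝ :=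
  ∑ j, ∑ k, c j * c k * boxKernel (ε j) (x j) (ε k) (x k) t

lemma exists_bddSupp_combination (hε : ∀ j, 0 < ε j) :
    ∃ M R, BddSupp M R (fun y => ∑ j, c j * boxDensity (ε j) (x j) y) :=
  ⟨_, _, BddSupp.sum (fun j => boxRadius_nonneg (ε j) (x j))
    (fun j => bddSupp_boxDensity (hε j) (x j)) c⟩

lemma gaussEnergy_combination (hε : ∀ j, 0 < ε j) {t : ℝ} (ht : 0 ≤ t) :
    gaussEnergy t (fun y => ∑ j, c j * boxDensity (ε j) (x j) y) = boxForm ε x c t := by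
  have h1 : ∀ p : E d × E d, (∑ j, c j * boxDensity (ε j) (x j) p.1) *
      (∑ j, c j * boxDensity (ε j) (x j) p.2) * Real.exp (-(t * ‖p.1 - p.2‖ ^ 2)) =
      ∑ j, ∑ k, c j * c k * (boxDensity (ε j) (x j) p.1 * boxDensity (ε k) (x k) p.2 *
        Real.exp (-(t * ‖p.1 - p.2‖ ^ 2))) := fun p => by
    rw [Finset.sum_mul_sum, Finset.sum_mul]
    refine Finset.sum_congr rfl fun j _ => ?_
    rw [Finset.sum_mul]
    exact Finset.sum_congr rfl fun k _ => by ring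
  simp_rw [gaussEnergy, h1]
  have h2 := fun j k => integral_boxDensity_mul_gauss (hε j) (hε k) (x j) (x k) ht
  rw [integral_finsetSum _ fun j _ => integrable_finsetSum _ fun k _ => (h2 j k).1.const_mul _]
  refine Finset.sum_congr rfl fun j _ => ?_
  rw [integral_finsetSum _ fun k _ => (h2 j k).1.const_mul _]
  refine Finset.sum_congr rfl fun k _ => ?_
  rw [integral_const_mul, (h2 j k).2]

lemma integral_combination (hε : ∀ j, 0 < ε j) :
    ∫ y, ∑ j, c j * boxDensity (ε j) (x j) y = ∑ j, c j := by
  rw [integral_finsetSum _ fun j _ => (bddSupp_boxDensity (hε j) (x j)).integrable.const_mul _]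
  simp_rw [integral_const_mul, integral_boxDensity (hε _), mul_one]

lemma boxForm_nonneg (hε : ∀ j, 0 < ε j) {t : ℝ} (ht : 0 < t) : 0 ≤ boxForm ε x c t := by
  obtain ⟨M, R, h⟩ := exists_bddSupp_combination x c hε
  rw [← gaussEnergy_combination x c hε ht.le]
  exact gaussEnergy_nonneg h ht

variable {x c}

lemma integrableOn_boxForm (hd : 1 ≤ d) (hε : ∀ j, 0 < ε j) (hc : ∑ j, c j = 0) :
    IntegrableOn (fun t => t⁻¹ * boxForm ε x c t) (Set.Ioi 0) := by
  obtain ⟨M, R, h⟩ := exists_bddSupp_combination x c hε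
  refine (integrableOn_gaussEnergy hd h (by rw [integral_combination x c hε, hc])).congr_fun
    (fun t ht => ?_) measurableSet_Ioi
  simp only
  rw [gaussEnergy_combination x c hε (le_of_lt ht)]

lemma logEnergy_combination (hd : 1 ≤ d) (hε : ∀ j, 0 < ε j) (hc : ∑ j, c j = 0) :
    logEnergy (fun y => ∑ j, c j * boxDensity (ε j) (x j) y) =
      1 / 2 * ∫ t in Set.Ioi (0 : ℝ), t⁻¹ * boxForm ε x c t := by
  obtain ⟨M, R, h⟩ := exists_bddSupp_combination x c hε
  rw [logEnergy_eq hd h (by rw [integral_combination x c hε, hc])]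
  congr 1
  refine setIntegral_congr_fun measurableSet_Ioi fun t ht => ?_
  rw [gaussEnergy_combination x c hε (le_of_lt ht)]

end Combination

end Energy

/-! ### Mean square limits -/

section SquareLimits

variable {Ω : Type*} [MeasurableSpace Ω] {P : Measure Ω}

lemma eLpNorm_two_eq {Z : Ω → ℝ} (hZ : MemLp Z 2 P) :
    eLpNorm Z 2 P = ENNReal.ofReal (√(∫ ω, Z ω ^ 2 ∂P)) := by
  rw [hZ.eLpNorm_eq_integral_rpow_norm two_ne_zero ENNReal.ofNat_ne_top, Real.sqrt_eq_rpow]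
  simp

lemma tendsto_integral_sq {Z : ℕ → Ω → ℝ} {Y : Ω → ℝ} (hZ : ∀ n, MemLp (Z n) 2 P)
    (hY : MemLp Y 2 P) (h : Tendsto (fun n => eLpNorm (fun ω => Z n ω - Y ω) 2 P) atTop (𝓝 0)) :
    Tendsto (fun n => ∫ ω, Z n ω ^ 2 ∂P) atTop (𝓝 (∫ ω, Y ω ^ 2 ∂P)) := by
  have h1 : Tendsto (fun n => (hZ n).toLp (Z n)) atTop (𝓝 (hY.toLp Y)) :=
    (Lp.tendsto_Lp_iff_tendsto_eLpNorm'' Z hZ Y hY).2 h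
  have h2 : ∀ {X : Ω → ℝ} (hX : MemLp X 2 P), ‖hX.toLp X‖ ^ 2 = ∫ ω, X ω ^ 2 ∂P := fun hX => by
    rw [Lp.norm_toLp, eLpNorm_two_eq hX, ENNReal.toReal_ofReal (Real.sqrt_nonneg _),
      Real.sq_sqrt (integral_nonneg fun ω => sq_nonneg _)]
  simpa only [h2] using h1.norm.pow 2

/-- Mean square convergence gives almost sure convergence along a subsequence, and then dominated
convergence applies. A subsequence suffices to identify a limit. -/
lemma exists_tendsto_integral_cexp [IsFiniteMeasure P] {Z : ℕ → Ω → ℝ} {Y : Ω → ℝ}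
    (hZ : ∀ n, MemLp (Z n) 2 P) (hY : MemLp Y 2 P)
    (h : Tendsto (fun n => eLpNorm (fun ω => Z n ω - Y ω) 2 P) atTop (𝓝 0)) :
    ∃ ns : ℕ → ℕ, StrictMono ns ∧
      Tendsto (fun n => ∫ ω, Complex.exp (Z (ns n) ω * Complex.I) ∂P) atTop
        (𝓝 (∫ ω, Complex.exp (Y ω * Complex.I) ∂P)) := by
  obtain ⟨ns, hns, hlim⟩ := (tendstoInMeasure_of_tendsto_eLpNorm two_ne_zero
    (fun n => (hZ n).aestronglyMeasurable) hY.aestronglyMeasurable h).exists_seq_tendsto_ae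
  refine ⟨ns, hns, tendsto_integral_of_dominated_convergence (fun _ => 1) (fun n => ?_)
    (integrable_const _) (fun n => ae_of_all _ fun ω => ?_) ?_⟩
  · exact Continuous.comp_aestronglyMeasurable
      (g := fun x : ℝ => Complex.exp (x * Complex.I)) (by fun_prop) (hZ _).aestronglyMeasurable
  · rw [Complex.norm_exp_ofReal_mul_I]
  · filter_upwards [hlim] with ω hω
    exact (((Complex.continuous_ofReal.tendsto _).comp hω).mul_const _).cexp

lemma exists_eLpNorm_limit {Z : ℕ → Ω → ℝ} (hZ : ∀ n, MemLp (Z n) 2 P)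
    (h : Tendsto (fun n : ℕ × ℕ => eLpNorm (fun ω => Z n.1 ω - Z n.2 ω) 2 P) atTop (𝓝 0)) :
    ∃ Y : Ω → ℝ, MemLp Y 2 P ∧
      Tendsto (fun n => eLpNorm (fun ω => Z n ω - Y ω) 2 P) atTop (𝓝 0) := by
  have h1 : CauchySeq (fun n => (hZ n).toLp (Z n)) := by
    rw [Lp.cauchySeq_Lp_iff_cauchySeq_eLpNorm]
    refine h.congr fun n => eLpNorm_congr_ae ?_
    filter_upwards [(hZ n.1).coeFn_toLp, (hZ n.2).coeFn_toLp] with ω h1 h2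
    simp [h1, h2]
  obtain ⟨Y, hY⟩ := cauchySeq_tendsto_of_complete h1
  refine ⟨Y, Lp.memLp Y, ?_⟩
  rw [Lp.tendsto_Lp_iff_tendsto_eLpNorm'] at hY
  refine hY.congr fun n => eLpNorm_congr_ae ?_
  filter_upwards [(hZ n).coeFn_toLp] with ω h1
  simp [h1]

end SquareLimits

/-! ### Mollified boxes -/

section Mollification

variable {d : ℕ}

/-- Total mass one makes differences of mollified averages admissible for the Gaussian hypothesis,
which concerns only integral zero. It serves both for the sphere and for boxes. -/
lemma integral_mollification {ν : Measure (E d)} [IsFiniteMeasure ν] (hν : ν ≠ 0) (n : ℕ) :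
    ∫ x, ⨍ y, (bump d n).normed volume (x - y) ∂ν = 1 := by
  have : NeZero ν := ⟨hν⟩
  have hc : Continuous ((bump d n).normed volume) := (bump d n).continuous_normed
  have hi : Integrable ((bump d n).normed volume) := (bump d n).integrable_normed
  simp_rw [average_eq']
  rw [integral_integral_swap]
  · simp_rw [integral_sub_right_eq_self (fun x => (bump d n).normed volume x),
      (bump d n).integral_normed]
    simp
  · rw [integrable_prod_iff' (Continuous.aestronglyMeasurable (by fun_prop))]
    refine ⟨ae_of_all _ fun y => hi.comp_sub_right y, ?_⟩
    have : ∀ y, ∫ x, ‖(bump d n).normed volume (x - y)‖ =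
      ∫ x, ‖(bump d n).normed volume x‖ := fun y =>
        integral_sub_right_eq_self (fun x => ‖(bump d n).normed volume x‖) y
    simp only [Function.uncurry, this]
    exact integrable_const _

lemma sphereMeasure_ne_zero (hd : 1 ≤ d) : sphereMeasure d ≠ 0 := by
  have : Nonempty (Fin d) := ⟨⟨0, by omega⟩⟩
  have : Nontrivial (E d) := inferInstance
  rw [sphereMeasure, Ne, Measure.map_eq_zero_iff (by fun_prop)]
  exact Measure.toSphere_ne_zero _

instance : IsFiniteMeasure (sphereMeasure d) := by
  unfold sphereMeasure; infer_instance

lemma measurableSet_box (ε : ℝ) (x : E d) : MeasurableSet {y : E d | ∀ i, |y i - x i| ≤ ε} := by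
  have : {y : E d | ∀ i, |y i - x i| ≤ ε} = ⋂ i, {y : E d | |y i - x i| ≤ ε} := by
    ext; simp
  rw [this]
  exact MeasurableSet.iInter fun i => measurableSet_le (by fun_prop) measurable_const

lemma volume_real_box {ε : ℝ} (hε : 0 < ε) (x : E d) :
    volume.real {y : E d | ∀ i, |y i - x i| ≤ ε} = (2 * ε) ^ d := by
  have h := integral_boxDensity hε x
  rw [boxDensity_eq_indicator, integral_indicator (measurableSet_box ε x), setIntegral_const,
    smul_eq_mul] at h
  have h2 : (2 * ε) ^ d ≠ 0 := by positivity
  rw [mul_inv_eq_one₀ h2] at h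
  exact h

/-- The density of the uniform measure on a box, mollified at scale `1/(n+1)`. -/
noncomputable def mollifiedBox (ε : ℝ) (x : E d) (n : ℕ) : E d → ℝ :=
  convolution (boxDensity ε x) ((bump d n).normed volume) (ContinuousLinearMap.lsmul ℝ ℝ) volume

lemma mollifiedBox_apply (ε : ℝ) (x : E d) (n : ℕ) (z : E d) :
    mollifiedBox ε x n z = ∫ y, boxDensity ε x y * (bump d n).normed volume (z - y) := rfl

lemma average_box_eq {ε : ℝ} (hε : 0 < ε) (x : E d) (n : ℕ) (z : E d) :
    ⨍ y, (bump d n).normed volume (z - y) ∂(boxMeasure ε x) = mollifiedBox ε x n z := by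
  rw [boxMeasure, setAverage_eq, volume_real_box hε, mollifiedBox_apply, boxDensity_eq_indicator,
    smul_eq_mul, ← integral_const_mul, ← integral_indicator (measurableSet_box ε x)]
  congr 1
  ext y
  by_cases hy : y ∈ {y : E d | ∀ i, |y i - x i| ≤ ε}
  · rw [Set.indicator_of_mem hy, Set.indicator_of_mem hy]
  · rw [Set.indicator_of_notMem hy, Set.indicator_of_notMem hy, zero_mul]

lemma mollifiedBox_eq_zero {ε : ℝ} {x : E d} {n : ℕ} {z : E d} (h : boxRadius ε x + 1 < ‖z‖) :
    mollifiedBox ε x n z = 0 := by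
  rw [mollifiedBox_apply]
  refine integral_eq_zero_of_ae (ae_of_all _ fun y => ?_)
  simp only [Pi.zero_apply]
  by_contra hne
  have h1 : ‖y‖ ≤ boxRadius ε x := by
    by_contra! h'
    exact hne (by rw [boxDensity_eq_zero h', zero_mul])
  have h2 : ‖z - y‖ < 1 := by
    have h3 : z - y ∈ Function.support ((bump d n).normed volume) := right_ne_zero_of_mul hne
    rw [(bump d n).support_normed_eq, mem_ball_zero_iff] at h3
    refine h3.trans_le ?_
    simp only [bump]
    rw [div_le_one (by positivity)]
    linarith [Nat.cast_nonneg (α := ℝ) n]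
  have h4 : ‖z‖ ≤ ‖z - y‖ + ‖y‖ := by simpa using norm_add_le (z - y) y
  linarith

lemma contDiff_mollifiedBox {ε : ℝ} (hε : 0 < ε) (x : E d) (n : ℕ) :
    ContDiff ℝ (⊤ : ℕ∞) (mollifiedBox ε x n) :=
  (bump d n).hasCompactSupport_normed.contDiff_convolution_right _
    (bddSupp_boxDensity hε x).integrable.locallyIntegrable (bump d n).contDiff_normed

lemma hasCompactSupport_mollifiedBox (ε : ℝ) (x : E d) (n : ℕ) :
    HasCompactSupport (mollifiedBox ε x n) :=
  HasCompactSupport.intro (isCompact_closedBall (0 : E d) (boxRadius ε x + 1)) fun z hz =>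
    mollifiedBox_eq_zero (by simpa using hz)

lemma bddSupp_mollifiedBox {ε : ℝ} (hε : 0 < ε) (x : E d) (n : ℕ) :
    BddSupp ((2 * ε) ^ d)⁻¹ (boxRadius ε x + 1) (mollifiedBox ε x n) where
  meas := (contDiff_mollifiedBox hε x n).continuous.measurable
  bound z := by
    have h0 : ∀ y, 0 ≤ boxDensity ε x y * (bump d n).normed volume (z - y) := fun y =>
      mul_nonneg (boxDensity_nonneg hε x y) ((bump d n).nonneg_normed _)
    rw [mollifiedBox_apply, abs_of_nonneg (integral_nonneg h0)]
    calc ∫ y, boxDensity ε x y * (bump d n).normed volume (z - y)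
        ≤ ∫ y, ((2 * ε) ^ d)⁻¹ * (bump d n).normed volume (z - y) := by
          refine integral_mono_of_nonneg (ae_of_all _ h0)
            (((bump d n).integrable_normed.comp_sub_left z).const_mul _) (ae_of_all _ fun y => ?_)
          exact mul_le_mul_of_nonneg_right (boxDensity_le hε x y) ((bump d n).nonneg_normed _)
      _ = ((2 * ε) ^ d)⁻¹ := by
          rw [integral_const_mul, integral_sub_left_eq_self (fun y => (bump d n).normed volume y),
            (bump d n).integral_normed, mul_one]
  supp _ hz := mollifiedBox_eq_zero hz

/-- Lebesgue differentiation; `K = 2` is the ratio of the outer to the inner radius of every bump.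
-/
lemma ae_tendsto_mollifiedBox {ε : ℝ} (hε : 0 < ε) (x : E d) :
    ∀ᵐ z, Tendsto (fun n => mollifiedBox ε x n z) atTop (𝓝 (boxDensity ε x z)) := by
  have h := ContDiffBump.ae_convolution_tendsto_right_of_locallyIntegrable (μ := volume)
    (φ := fun n => bump d n) (l := atTop) (K := 2) (g := boxDensity ε x)
    (by simpa only [bump] using tendsto_one_div_add_atTop_nhds_zero_nat)
    (Eventually.of_forall fun n => by
      simp only [bump]
      have : (0 : ℝ) < (n : ℝ) + 1 := by positivity
      field_simp
      norm_num)
    (bddSupp_boxDensity hε x).integrable.locallyIntegrable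
  filter_upwards [h] with z hz
  refine hz.congr fun n => ?_
  rw [mollifiedBox, convolution_lsmul_swap, convolution_def]
  simp only [ContinuousLinearMap.lsmul_apply, smul_eq_mul, mul_comm]

lemma isFiniteMeasure_boxMeasure {ε : ℝ} (hε : 0 < ε) (x : E d) :
    IsFiniteMeasure (boxMeasure ε x) := by
  refine ⟨?_⟩
  rw [boxMeasure, Measure.restrict_apply_univ]
  refine lt_top_iff_ne_top.2 fun h => ?_
  have h1 := volume_real_box hε x
  rw [measureReal_def, h, ENNReal.toReal_top] at h1
  have : 0 < (2 * ε) ^ d := by positivity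
  linarith

lemma boxMeasure_ne_zero {ε : ℝ} (hε : 0 < ε) (x : E d) : boxMeasure ε x ≠ 0 := by
  intro h
  have h1 := volume_real_box hε x
  rw [measureReal_def, ← Measure.restrict_apply_univ] at h1
  rw [boxMeasure] at h
  rw [h] at h1
  have : 0 < (2 * ε) ^ d := by positivity
  simp at h1
  linarith

/-- The mollified box density as a Schwartz function. -/
noncomputable def boxTest {ε : ℝ} (hε : 0 < ε) (x : E d) (n : ℕ) : 𝓢(E d, ℝ) :=
  (hasCompactSupport_mollifiedBox ε x n).toSchwartzMap (contDiff_mollifiedBox hε x n)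

lemma boxTest_apply {ε : ℝ} (hε : 0 < ε) (x : E d) (n : ℕ) (z : E d) :
    boxTest hε x n z = mollifiedBox ε x n z := rfl

lemma integral_boxTest {ε : ℝ} (hε : 0 < ε) (x : E d) (n : ℕ) : ∫ z, boxTest hε x n z = 1 := by
  have := isFiniteMeasure_boxMeasure hε x
  simp_rw [boxTest_apply, ← average_box_eq hε]
  exact integral_mollification (boxMeasure_ne_zero hε x) n

end Mollification

/-! ### Box averages of the field -/

section Field

variable {Ω : Type*} [MeasurableSpace Ω] {d : ℕ} {P : Measure Ω}
  {h : Ω → (𝓢(E d, ℝ) →L[ℝ] ℝ)}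

namespace IsLGF

lemma hasGaussianLaw (hh : IsLGF P h) {f : 𝓢(E d, ℝ)} (hf : ∫ x, f x = 0) :
    HasGaussianLaw (fun ω => h ω f) P :=
  hh.gaussian.hasGaussianLaw_eval ⟨f, hf⟩

lemma variance_eq (hh : IsLGF P h) {f : 𝓢(E d, ℝ)} (hf : ∫ x, f x = 0) :
    Var[fun ω => h ω f; P] = logEnergy f := by
  rw [← covariance_self (hh.measurable f).aemeasurable, hh.covariance f f hf hf, logEnergy]

lemma integral_sq (hh : IsLGF P h) {f : 𝓢(E d, ℝ)} (hf : ∫ x, f x = 0) :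
    ∫ ω, h ω f ^ 2 ∂P = logEnergy f := by
  rw [← hh.variance_eq hf,
    variance_of_integral_eq_zero (hh.measurable f).aemeasurable (hh.centered f hf)]

lemma integral_cexp (hh : IsLGF P h) {f : 𝓢(E d, ℝ)} (hf : ∫ x, f x = 0) :
    ∫ ω, Complex.exp (h ω f * Complex.I) ∂P = Complex.exp (-(logEnergy f / 2 : ℝ)) := by
  have h1 := (hh.hasGaussianLaw hf).charFun_map_eq (1 : ℝ)
  rw [charFun_apply_real, integral_map (hh.measurable f).aemeasurable
    (Continuous.aestronglyMeasurable (by fun_prop))] at h1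
  simp only [Complex.ofReal_one, one_mul, RCLike.inner_apply, conj_trivial,
    mul_one, hh.centered f hf, hh.variance_eq hf] at h1
  rw [h1]
  simp

/-- Only test functions of integral zero are Gaussian by hypothesis. The normalization supplies one
test function of integral one with finite second moment, and subtracting a multiple of it from `f`
leaves integral zero. -/
lemma memLp (hh : IsLGF P h) (hd : 1 ≤ d) (f : 𝓢(E d, ℝ)) : MemLp (fun ω => h ω f) 2 P := by
  obtain ⟨-, s, hs, hlim⟩ := hh.normalized
  obtain ⟨n, hn⟩ := (hlim.eventually (gt_mem_nhds ENNReal.zero_lt_top)).exists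
  have h1 : MemLp (fun ω => h ω (s n)) 2 P :=
    ⟨(hh.measurable _).aestronglyMeasurable, by simpa using hn⟩
  have h2 : ∫ x, s n x = 1 := by
    simp_rw [hs]
    exact integral_mollification (sphereMeasure_ne_zero hd) n
  have h3 : ∫ x, (f - (∫ x, f x) • s n) x = 0 := by
    simp only [sub_apply, smul_apply, smul_eq_mul]
    rw [integral_sub f.integrable ((s n).integrable.const_mul _), integral_const_mul, h2, mul_one,
      sub_self]
  refine ((hh.hasGaussianLaw h3).memLp_two.add (h1.const_mul (∫ x, f x))).congr_norm
    (hh.measurable f).aestronglyMeasurable (ae_of_all _ fun ω => ?_)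
  simp

/-- The differences of mollified boxes have integral zero, so their second moments are energies,
which tend to zero. Thus the `L²` limit exists and the default value in `boxAverage` is never taken.
-/
lemma isAverage_boxAverage (hh : IsLGF P h) (hd : 1 ≤ d) {ε : ℝ} (hε : 0 < ε) (x : E d) :
    IsAverage P h (boxMeasure ε x) (boxAverage P h ε x) := by
  have H : ∃ X : Ω → ℝ, IsAverage P h (boxMeasure ε x) X := by
    have hF : ∀ n : ℕ × ℕ, BddSupp (((2 * ε) ^ d)⁻¹ + ((2 * ε) ^ d)⁻¹) (boxRadius ε x + 1)
        (boxTest hε x n.1 - boxTest hε x n.2) := fun n =>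
      ⟨(bddSupp_mollifiedBox hε x n.1).meas.sub (bddSupp_mollifiedBox hε x n.2).meas, fun z =>
        (abs_sub _ _).trans (add_le_add ((bddSupp_mollifiedBox hε x n.1).bound z)
          ((bddSupp_mollifiedBox hε x n.2).bound z)), fun z hz => by
        simp [boxTest_apply, mollifiedBox_eq_zero hz]⟩
    have hlim : Tendsto (fun n : ℕ × ℕ => logEnergy (boxTest hε x n.1 - boxTest hε x n.2)) atTop
        (𝓝 (logEnergy (d := d) 0)) := by
      refine tendsto_logEnergy hd hF ?_
      filter_upwards [ae_tendsto_mollifiedBox hε x] with z hz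
      rw [← prod_atTop_atTop_eq]
      simpa [boxTest_apply] using (hz.comp tendsto_fst).sub (hz.comp tendsto_snd)
    have h0 : logEnergy (d := d) 0 = 0 := by simp [logEnergy]
    have hZ := fun n => hh.memLp hd (boxTest hε x n)
    obtain ⟨Y, hY, hYlim⟩ := exists_eLpNorm_limit hZ (by
      have h1 : ∀ n : ℕ × ℕ, eLpNorm (fun ω => h ω (boxTest hε x n.1) - h ω (boxTest hε x n.2)) 2 P
          = ENNReal.ofReal (√(logEnergy (boxTest hε x n.1 - boxTest hε x n.2))) := fun n => by
        have h2 : ∫ z, (boxTest hε x n.1 - boxTest hε x n.2) z = 0 := by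
          simp only [sub_apply]
          rw [integral_sub (SchwartzMap.integrable _) (SchwartzMap.integrable _),
            integral_boxTest, integral_boxTest, sub_self]
        have h3 := hh.integral_sq h2
        simp only [map_sub] at h3
        have h4 := eLpNorm_two_eq ((hZ n.1).sub (hZ n.2))
        simp only [Pi.sub_apply] at h4
        rw [h3] at h4
        exact h4
      simp_rw [h1]
      rw [h0] at hlim
      simpa using ENNReal.tendsto_ofReal hlim.sqrt)
    exact ⟨Y, hY, boxTest hε x, fun n z => (average_box_eq hε x n z).symm, hYlim⟩
  unfold boxAverage
  rw [dif_pos H]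
  exact H.choose_spec

lemma memLp_boxAverage (hh : IsLGF P h) (hd : 1 ≤ d) {ε : ℝ} (hε : 0 < ε) (x : E d) :
    MemLp (boxAverage P h ε x) 2 P :=
  (hh.isAverage_boxAverage hd hε x).1

lemma tendsto_boxAverage (hh : IsLGF P h) (hd : 1 ≤ d) {ε : ℝ} (hε : 0 < ε) (x : E d) :
    Tendsto (fun n => eLpNorm (fun ω => h ω (boxTest hε x n) - boxAverage P h ε x ω) 2 P) atTop
      (𝓝 0) := by
  obtain ⟨-, f, hf, hlim⟩ := hh.isAverage_boxAverage hd hε x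
  -- `IsAverage` prescribes the test functions pointwise, so the chosen sequence is the explicit
  -- one.
  have : f = boxTest hε x := by
    ext n z
    rw [hf, average_box_eq hε]
    rfl
  rwa [this] at hlim

variable {J : Type*} [Fintype J] {ε : J → ℝ} {x : J → E d} {c : J → ℝ}

lemma tendsto_combination (hh : IsLGF P h) (hd : 1 ≤ d) (hε : ∀ j, 0 < ε j) :
    Tendsto (fun n => eLpNorm (fun ω => h ω (∑ j, c j • boxTest (hε j) (x j) n) -
      ∑ j, c j * boxAverage P h (ε j) (x j) ω) 2 P) atTop (𝓝 0) := by
  have h1 : Tendsto (fun n => ∑ j, ENNReal.ofReal |c j| *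
      eLpNorm (fun ω => h ω (boxTest (hε j) (x j) n) - boxAverage P h (ε j) (x j) ω) 2 P)
      atTop (𝓝 0) := by
    have h2 := tendsto_finsetSum (Finset.univ : Finset J) fun j _ =>
      ENNReal.Tendsto.const_mul (a := ENNReal.ofReal |c j|)
        (hh.tendsto_boxAverage hd (hε j) (x j)) (Or.inr ENNReal.ofReal_ne_top)
    simpa using h2
  refine tendsto_of_tendsto_of_tendsto_of_le_of_le tendsto_const_nhds h1 (fun _ => zero_le)
    fun n => ?_
  have h3 : (fun ω => h ω (∑ j, c j • boxTest (hε j) (x j) n) -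
      ∑ j, c j * boxAverage P h (ε j) (x j) ω) = ∑ j, c j • (fun ω => h ω (boxTest (hε j) (x j) n) -
        boxAverage P h (ε j) (x j) ω) := by
    ext ω
    simp [← Finset.sum_sub_distrib, mul_sub, Finset.sum_apply]
  rw [h3]
  refine (eLpNorm_sum_le (fun j _ => ?_) (by norm_num)).trans (Finset.sum_le_sum fun j _ => ?_)
  · exact (((hh.measurable _).aestronglyMeasurable).sub
      (hh.memLp_boxAverage hd (hε j) (x j)).aestronglyMeasurable).const_smul _
  · rw [eLpNorm_const_smul, Real.enorm_eq_ofReal_abs]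

/-- Combinations of box averages with total weight zero are centered Gaussian, with variance given
by the Gaussian kernels averaged over boxes. -/
theorem combination [IsProbabilityMeasure P] (hh : IsLGF P h) (hd : 1 ≤ d) (hε : ∀ j, 0 < ε j) (hc : ∑ j, c j = 0) :
    ∫ ω, (∑ j, c j * boxAverage P h (ε j) (x j) ω) ^ 2 ∂P =
      1 / 2 * ∫ t in Set.Ioi (0 : ℝ), t⁻¹ * boxForm ε x c t ∧
    ∫ ω, Complex.exp ((∑ j, c j * boxAverage P h (ε j) (x j) ω : ℝ) * Complex.I) ∂P =
      Complex.exp (-((1 / 2 * ∫ t in Set.Ioi (0 : ℝ), t⁻¹ * boxForm ε x c t) / 2 : ℝ)) := by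
  set F : ℕ → 𝓢(E d, ℝ) := fun n => ∑ j, c j • boxTest (hε j) (x j) n with hFdef
  have hFapp : ∀ n z, F n z = ∑ j, c j * mollifiedBox (ε j) (x j) n z := fun n z => by
    simp [hFdef, boxTest_apply]
  -- The weights sum to zero, so the approximations have integral exactly zero and are Gaussian
  -- before passing to the limit.
  have hF0 : ∀ n, ∫ z, F n z = 0 := fun n => by
    have h1 : ∀ z, F n z = ∑ j, c j * boxTest (hε j) (x j) n z := hFapp n
    simp_rw [h1]
    rw [integral_finsetSum _ fun j _ => (SchwartzMap.integrable _).const_mul _]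
    simp_rw [integral_const_mul, integral_boxTest, mul_one, hc]
  have hlim : Tendsto (fun n => logEnergy (F n)) atTop
      (𝓝 (logEnergy (fun y => ∑ j, c j * boxDensity (ε j) (x j) y))) := by
    refine tendsto_logEnergy hd (M := ∑ j, |c j| * ((2 * ε j) ^ d)⁻¹)
      (R := ∑ j, (boxRadius (ε j) (x j) + 1)) (fun n => ?_) ?_
    · have := BddSupp.sum (fun j => add_nonneg (boxRadius_nonneg (ε j) (x j)) zero_le_one)
        (fun j => bddSupp_mollifiedBox (hε j) (x j) n) c
      convert this using 1
      exact funext (hFapp n)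
    · have h1 : ∀ᵐ z, ∀ j, Tendsto (fun n => mollifiedBox (ε j) (x j) n z) atTop
          (𝓝 (boxDensity (ε j) (x j) z)) :=
        ae_all_iff.2 fun j => ae_tendsto_mollifiedBox (hε j) (x j)
      filter_upwards [h1] with z hz
      simp_rw [hFapp]
      exact tendsto_finsetSum _ fun j _ => (hz j).const_mul _
  have hZ : ∀ n, MemLp (fun ω => h ω (F n)) 2 P := fun n => hh.memLp hd _
  have hY : MemLp (fun ω => ∑ j, c j * boxAverage P h (ε j) (x j) ω) 2 P :=
    memLp_finsetSum _ fun j _ => (hh.memLp_boxAverage hd (hε j) (x j)).const_mul _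
  have hconv := hh.tendsto_combination hd hε (x := x) (c := c)
  rw [← logEnergy_combination hd hε hc]
  constructor
  · have h1 := tendsto_integral_sq hZ hY hconv
    simp_rw [hh.integral_sq (hF0 _)] at h1
    exact tendsto_nhds_unique h1 hlim
  · obtain ⟨ns, hns, h1⟩ := exists_tendsto_integral_cexp hZ hY hconv
    simp_rw [hh.integral_cexp (hF0 _)] at h1
    refine tendsto_nhds_unique h1 ?_
    have h2 := (((hlim.comp hns.tendsto_atTop).div_const 2).neg)
    have h3 := (((Complex.continuous_ofReal.tendsto _).comp h2)).cexp
    simpa using h3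

end IsLGF

end Field

/-! ### The lattice metric -/

section LatticeMetric

variable {d : ℕ}

/-- Changing the field by at most `s / ξ` changes distances at most by the factor `exp s`. -/
lemma setDist_le_mul {ε ξ s : ℝ} (hε : 0 ≤ ε) {φ ψ : (Fin d → ℤ) → ℝ}
    {A : Set (Fin d → ℤ)} (h : ∀ z ∈ A, ξ * φ z ≤ s + ξ * ψ z) (B C : Set (Fin d → ℤ)) :
    setDist ε ξ φ A B C ≤ ENNReal.ofReal (Real.exp s) * setDist ε ξ ψ A B C := by
  have h0 : ENNReal.ofReal (Real.exp s) ≠ 0 := (ENNReal.ofReal_pos.2 (Real.exp_pos s)).ne'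
  have h1 : ENNReal.ofReal (Real.exp s) ≠ ∞ := ENNReal.ofReal_ne_top
  simp only [setDist, dist, ENNReal.mul_iInf_of_ne h0 h1]
  refine iInf_mono fun z => iInf_mono fun hz => iInf_mono fun w => iInf_mono fun hw =>
    iInf_mono fun N => iInf_mono fun P => iInf_mono fun hP => ?_
  rw [← ENNReal.ofReal_mul (Real.exp_pos s).le]
  refine ENNReal.ofReal_le_ofReal ?_
  rw [pathLength, pathLength, Finset.mul_sum]
  refine Finset.sum_le_sum fun i _ => ?_
  calc ε * Real.exp (ξ * φ (P i)) ≤ ε * Real.exp (s + ξ * ψ (P i)) :=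
        mul_le_mul_of_nonneg_left (Real.exp_le_exp.2 (h _ (hP.mem i))) hε
    _ = Real.exp s * (ε * Real.exp (ξ * ψ (P i))) := by rw [Real.exp_add]; ring

lemma setDist_congr {ε ξ : ℝ} (hε : 0 ≤ ε) {φ ψ : (Fin d → ℤ) → ℝ}
    {A : Set (Fin d → ℤ)} (h : ∀ z ∈ A, φ z = ψ z) (B C : Set (Fin d → ℤ)) :
    setDist ε ξ φ A B C = setDist ε ξ ψ A B C := by
  refine le_antisymm ?_ ?_
  · simpa using setDist_le_mul (s := 0) hε (fun z hz => by rw [h z hz, zero_add]) B C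
  · simpa using setDist_le_mul (s := 0) hε (fun z hz => by rw [h z hz, zero_add]) B C

/-- All the infima are over countable types, since endpoints and paths are made of integer points.
-/
lemma measurable_setDist {X : Type*} [MeasurableSpace X] (ε ξ : ℝ)
    {φ : X → (Fin d → ℤ) → ℝ} (hφ : ∀ z, Measurable (fun x => φ x z))
    (A B C : Set (Fin d → ℤ)) : Measurable (fun x => setDist ε ξ (φ x) A B C) := by
  unfold setDist dist pathLength
  refine Measurable.iInf fun z => Measurable.iInf fun _ => Measurable.iInf fun w =>
    Measurable.iInf fun _ => Measurable.iInf fun N => Measurable.iInf fun P =>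
    Measurable.iInf fun _ => ENNReal.measurable_ofReal.comp ?_
  exact Finset.measurable_fun_sum _ fun i _ =>
    (Real.measurable_exp.comp ((hφ _).const_mul ξ)).const_mul ε

/-- The embedding of `ℤ^d` into `ℤ^(d+k)` as the sublattice where the last `k` coordinates
vanish. -/
def extend (k : ℕ) (z : Fin d → ℤ) : Fin (d + k) → ℤ := Fin.append z 0

lemma adj_extend {k : ℕ} {z w : Fin d → ℤ} (h : Adj z w) : Adj (extend k z) (extend k w) := by
  unfold Adj extend at *
  simpa [Fin.sum_univ_add] using h

lemma latticePoint_apply (ε : ℝ) (z : Fin d → ℤ) (i : Fin d) :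
    latticePoint ε z i = ε * (z i : ℝ) := rfl

lemma extend_mem_cube {k : ℕ} {ε : ℝ} {z : Fin d → ℤ} (h : z ∈ cube d ε) :
    extend k z ∈ cube (d + k) ε := by
  intro i
  refine Fin.addCases (fun j => ?_) (fun j => ?_) i
  · simpa [latticePoint_apply, extend] using h j
  · simp [latticePoint_apply, extend]

lemma extend_mem_face {k : ℕ} (hd : 1 ≤ d) {ε a : ℝ} {z : Fin d → ℤ} (h : z ∈ face d ε a) :
    extend k z ∈ face (d + k) ε a := by
  refine ⟨extend_mem_cube h.1, fun i => ?_⟩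
  refine Fin.addCases (fun j hj => ?_) (fun j hj => ?_) i
  · simpa [latticePoint_apply, extend] using h.2 j (by simpa using hj)
  -- An added coordinate has index at least `d ≥ 1`, so it is never the one that defines the face.
  · simp at hj
    omega

/-- The crossing distance of the cube is at most that of the coordinate section of dimension
`d`. -/
lemma setDist_cube_extend_le {k : ℕ} (hd : 1 ≤ d) (ε ξ : ℝ) (φ : (Fin (d + k) → ℤ) → ℝ) :
    setDist ε ξ φ (cube (d + k) ε) (face (d + k) ε 0) (face (d + k) ε 1) ≤
      setDist ε ξ (fun z => φ (extend k z)) (cube d ε) (face d ε 0) (face d ε 1) := by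
  unfold setDist
  refine le_iInf₂ fun z hz => le_iInf₂ fun w hw => ?_
  refine (iInf₂_le (extend k z) (extend_mem_face hd hz)).trans
    ((iInf₂_le (extend k w) (extend_mem_face hd hw)).trans ?_)
  unfold dist
  refine le_iInf fun N => le_iInf₂ fun P hP => ?_
  refine (iInf_le _ N).trans (iInf₂_le_of_le (fun i => extend k (P i)) ⟨?_, ?_, ?_, ?_⟩ le_rfl)
  · rw [hP.start]
  · rw [hP.finish]
  · exact fun i => adj_extend (hP.step i)
  · exact fun i => extend_mem_cube (hP.mem i)

/-- The lattice cube at scale `1/(n+1)` in integer coordinates. -/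
noncomputable def cubeFinset (d n : ℕ) : Finset (Fin d → ℤ) := Fintype.piFinset fun _ => Finset.Icc 0 (n + 1)

lemma card_cubeFinset (d n : ℕ) : (cubeFinset d n).card = (n + 2) ^ d := by
  simp [cubeFinset, Fintype.card_piFinset]
  norm_cast

lemma zero_mem_cubeFinset (d n : ℕ) : (0 : Fin d → ℤ) ∈ cubeFinset d n := by
  simp only [cubeFinset, Fintype.mem_piFinset, Finset.mem_Icc, Pi.zero_apply]
  exact fun _ => ⟨le_rfl, by positivity⟩

lemma mem_cubeFinset_of_mem_cube {n : ℕ} {z : Fin d → ℤ}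
    (hz : z ∈ cube d (1 / ((n : ℝ) + 1))) : z ∈ cubeFinset d n := by
  have hn : (0 : ℝ) < (n : ℝ) + 1 := by positivity
  simp only [cubeFinset, Fintype.mem_piFinset, Finset.mem_Icc]
  intro i
  obtain ⟨h1, h2⟩ := hz i
  rw [latticePoint_apply, one_div, inv_mul_eq_div] at h1 h2
  rw [div_le_one hn] at h2
  rw [le_div_iff₀ hn, zero_mul] at h1
  exact ⟨by exact_mod_cast h1, by exact_mod_cast h2⟩

end LatticeMetric

/-! ### Estimates for the averaged kernels -/

section KernelEstimates

/-- The three ranges contribute `c * S`, `b * log (T / S)` and `B`. With `S = T` the middle one is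
empty and a bound uniform in the scale results; with `S = 1` and `T = ε⁻²` it gives the logarithmic
variance. -/
lemma integrableOn_Ioi_and_integral_le {f : ℝ → ℝ} {c b B S T : ℝ} (hS : 0 < S) (hST : S ≤ T)
    (hf : AEStronglyMeasurable f (volume.restrict (Set.Ioi 0))) (hf0 : ∀ t, 0 < t → 0 ≤ f t)
    (h1 : ∀ t, 0 < t → t ≤ S → f t ≤ c) (h2 : ∀ t, S < t → t ≤ T → f t ≤ b * t⁻¹)
    (h3 : ∀ t, T < t → f t ≤ B * T * t ^ (-2 : ℝ)) :
    IntegrableOn f (Set.Ioi 0) ∧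
      ∫ t in Set.Ioi 0, f t ≤ c * S + b * Real.log (T / S) + B := by
  have hT : 0 < T := hS.trans_le hST
  have hsub1 : Set.Ioc 0 S ⊆ Set.Ioi (0 : ℝ) := fun t ht => ht.1
  have hsub2 : Set.Ioc S T ⊆ Set.Ioi (0 : ℝ) := fun t ht => hS.trans ht.1
  have hsub3 : Set.Ioi T ⊆ Set.Ioi (0 : ℝ) := fun t ht => hT.trans ht
  have g1 : IntegrableOn (fun _ : ℝ => c) (Set.Ioc 0 S) := integrableOn_const (by simp)
  have g2 : IntegrableOn (fun t : ℝ => b * t⁻¹) (Set.Ioc S T) := by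
    rw [← intervalIntegrable_iff_integrableOn_Ioc_of_le hST]
    refine (ContinuousOn.intervalIntegrable ?_).const_mul b
    refine continuousOn_inv₀.mono fun t ht => ?_
    rw [Set.uIcc_of_le hST] at ht
    exact (hS.trans_le ht.1).ne'
  have g3 : IntegrableOn (fun t : ℝ => B * T * t ^ (-2 : ℝ)) (Set.Ioi T) :=
    (integrableOn_Ioi_rpow_of_lt (by norm_num) hT).const_mul _
  have main : ∀ {s : Set ℝ} {g : ℝ → ℝ}, MeasurableSet s → s ⊆ Set.Ioi 0 → IntegrableOn g s →
      (∀ t ∈ s, f t ≤ g t) → IntegrableOn f s ∧ ∫ t in s, f t ≤ ∫ t in s, g t := by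
    intro s g hs hsub hg hle
    have hi : IntegrableOn f s := by
      refine Integrable.mono' hg (hf.mono_set hsub) ?_
      filter_upwards [ae_restrict_mem hs] with t ht
      rw [Real.norm_of_nonneg (hf0 t (hsub ht))]
      exact hle t ht
    exact ⟨hi, setIntegral_mono_on hi hg hs hle⟩
  obtain ⟨i1, l1⟩ := main measurableSet_Ioc hsub1 g1 fun t ht => h1 t ht.1 ht.2
  obtain ⟨i2, l2⟩ := main measurableSet_Ioc hsub2 g2 fun t ht => h2 t ht.1 ht.2
  obtain ⟨i3, l3⟩ := main measurableSet_Ioi hsub3 g3 fun t ht => h3 t ht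
  have e1 : ∫ _t in Set.Ioc 0 S, c = c * S := by
    rw [setIntegral_const]
    simp [measureReal_def, hS.le, mul_comm]
  have e2 : ∫ t in Set.Ioc S T, b * t⁻¹ = b * Real.log (T / S) := by
    rw [integral_const_mul, ← intervalIntegral.integral_of_le hST, integral_inv_of_pos hS hT]
  have e3 : ∫ t in Set.Ioi T, B * T * t ^ (-2 : ℝ) = B := by
    rw [integral_const_mul, integral_Ioi_rpow_of_lt (by norm_num) hT]
    norm_num
    rw [Real.rpow_neg_one]
    field_simp
  have u1 : Set.Ioc 0 S ∪ Set.Ioi S = Set.Ioi 0 := Set.Ioc_union_Ioi_eq_Ioi hS.le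
  have u2 : Set.Ioc S T ∪ Set.Ioi T = Set.Ioi S := Set.Ioc_union_Ioi_eq_Ioi hST
  have i4 : IntegrableOn f (Set.Ioi S) := u2 ▸ i2.union i3
  refine ⟨u1 ▸ i1.union i4, ?_⟩
  rw [← u1, setIntegral_union (Set.Ioc_disjoint_Ioi le_rfl) measurableSet_Ioi i1 i4, ← u2,
    setIntegral_union (Set.Ioc_disjoint_Ioi le_rfl) measurableSet_Ioi i2 i3]
  linarith

variable {d : ℕ} {ε ε' : ℝ}

lemma boxKernel_nonneg (hε : 0 < ε) (hε' : 0 < ε') (x x' : E d) (t : ℝ) :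
    0 ≤ boxKernel ε x ε' x' t :=
  Finset.prod_nonneg fun _ _ => segKernel_nonneg hε hε' _ _ _

lemma boxKernel_le_one (hε : 0 < ε) (hε' : 0 < ε') (x x' : E d) {t : ℝ} (ht : 0 ≤ t) :
    boxKernel ε x ε' x' t ≤ 1 :=
  Finset.prod_le_one (fun _ _ => segKernel_nonneg hε hε' _ _ _)
    fun _ _ => segKernel_le_one hε hε' _ _ ht

/-- Each coordinate contributes a factor at most `B`, of order `t ^ (-1/2)`. Two coordinates already
give `t⁻¹`; the others are harmless if `B < 1`, and if `B ≥ 1` the trivial bound by one is enough.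
-/
lemma boxKernel_le_inv (hd : 2 ≤ d) (hε : 0 < ε) (hε' : 0 < ε') (x x' : E d) {t : ℝ}
    (ht : 0 < t) : boxKernel ε x ε' x' t ≤ (ε' ^ 2)⁻¹ * t⁻¹ := by
  set B := (2 * ε')⁻¹ * √(Real.pi / t) with hB
  have hB0 : 0 ≤ B := by positivity
  have hB2 : B ^ 2 ≤ (ε' ^ 2)⁻¹ * t⁻¹ := by
    rw [hB, mul_pow, Real.sq_sqrt (by positivity), inv_pow, mul_pow, div_eq_mul_inv, mul_inv]
    have h1 := Real.pi_le_four
    have h2 : 0 ≤ (ε' ^ 2)⁻¹ * t⁻¹ := by positivity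
    nlinarith
  refine le_trans ?_ hB2
  rcases le_or_gt 1 B with h | h
  · exact (boxKernel_le_one hε hε' x x' ht.le).trans (one_le_pow₀ h)
  · calc boxKernel ε x ε' x' t ≤ ∏ _i : Fin d, B :=
          Finset.prod_le_prod (fun _ _ => segKernel_nonneg hε hε' _ _ _)
            fun _ _ => segKernel_le_sqrt hε hε' _ _ ht
      _ = B ^ d := by simp
      _ ≤ B ^ 2 := pow_le_pow_of_le_one hB0 h.le hd

lemma measurable_boxKernel (x x' : E d) : Measurable (boxKernel ε x ε' x') :=
  Finset.measurable_fun_prod _ fun _ _ => measurable_segKernel _ _ _ _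

lemma boxKernel_comm (hε : 0 < ε) (hε' : 0 < ε') (x x' : E d) {t : ℝ} (ht : 0 ≤ t) :
    boxKernel ε x ε' x' t = boxKernel ε' x' ε x t := by
  rw [← (integral_boxDensity_mul_gauss hε hε' x x' ht).2,
    ← (integral_boxDensity_mul_gauss hε' hε x' x ht).2, Measure.volume_eq_prod,
    ← integral_prod_swap]
  refine integral_congr_ae (ae_of_all _ fun p => ?_)
  simp only [Prod.fst_swap, Prod.snd_swap]
  rw [norm_sub_rev, mul_comm (boxDensity ε x p.2)]

lemma one_sub_boxKernel_le (hε : 0 < ε) (hε' : 0 < ε') (x : E d) {t : ℝ} (ht : 0 ≤ t) :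
    1 - boxKernel ε x ε' x t ≤ d * (ε + ε') ^ 2 * t := by
  have h1 : Real.exp (-(d * (ε + ε') ^ 2 * t)) ≤ boxKernel ε x ε' x t := by
    calc Real.exp (-(d * (ε + ε') ^ 2 * t)) = ∏ _i : Fin d, Real.exp (-(t * (ε + ε') ^ 2)) := by
          rw [Finset.prod_const, Finset.card_univ, Fintype.card_fin, ← Real.exp_nat_mul]
          ring_nf
      _ ≤ boxKernel ε x ε' x t :=
          Finset.prod_le_prod (fun _ _ => (Real.exp_pos _).le) fun _ _ => le_segKernel hε hε' _ ht
  have h2 := Real.add_one_le_exp (-(d * (ε + ε') ^ 2 * t))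
  linarith

/-- The difference between one and the `k`-th power of the Gaussian kernel averaged twice over a
segment of radius `ε`. -/
noncomputable def kernelLoss (k : ℕ) (ε t : ℝ) : ℝ := 1 - segKernel ε 0 ε 0 t ^ k

lemma measurable_kernelLoss (k : ℕ) (ε : ℝ) : Measurable (kernelLoss k ε) :=
  measurable_const.sub ((measurable_segKernel _ _ _ _).pow_const k)

lemma kernelLoss_nonneg (k : ℕ) (hε : 0 < ε) {t : ℝ} (ht : 0 ≤ t) : 0 ≤ kernelLoss k ε t :=
  sub_nonneg.2 (pow_le_one₀ (segKernel_nonneg hε hε _ _ _) (segKernel_le_one hε hε _ _ ht))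

lemma kernelLoss_le_one (k : ℕ) (hε : 0 < ε) (t : ℝ) : kernelLoss k ε t ≤ 1 :=
  sub_le_self _ (pow_nonneg (segKernel_nonneg hε hε _ _ _) k)

lemma kernelLoss_le (k : ℕ) (hε : 0 < ε) {t : ℝ} (ht : 0 ≤ t) :
    kernelLoss k ε t ≤ 4 * k * ε ^ 2 * t := by
  have h1 := one_sub_boxKernel_le hε hε (0 : E k) ht
  have h2 : boxKernel ε (0 : E k) ε 0 t = segKernel ε 0 ε 0 t ^ k := by simp [boxKernel]
  rw [h2] at h1
  calc kernelLoss k ε t ≤ k * (ε + ε) ^ 2 * t := h1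
    _ = 4 * k * ε ^ 2 * t := by ring

/-- The covariance between the differences, for the restriction of the field from dimension `d + k`
to dimension `d`, of the averages over two boxes. -/
noncomputable def lossCov (k : ℕ) (ε : ℝ) (x x' : E d) : ℝ :=
  1 / 2 * ∫ t in Set.Ioi (0 : ℝ), t⁻¹ * (kernelLoss k ε t * boxKernel ε x ε x' t)

/-- With the cut at `t = ε⁻²`, the small range contributes at most `4k` because the loss is at most
`4kε²t`. The large range contributes at most `1` because the box kernel is at most `ε⁻²t⁻¹`. The
result does not depend on `ε`. -/
lemma lossCov_bound (hd : 2 ≤ d) (k : ℕ) (hε : 0 < ε) (x x' : E d) :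
    IntegrableOn (fun t => t⁻¹ * (kernelLoss k ε t * boxKernel ε x ε x' t)) (Set.Ioi 0) ∧
      lossCov k ε x x' ≤ 2 * k + 1 := by
  have hT : 0 < (ε ^ 2)⁻¹ := by positivity
  obtain ⟨h1, h2⟩ := integrableOn_Ioi_and_integral_le
    (f := fun t => t⁻¹ * (kernelLoss k ε t * boxKernel ε x ε x' t)) (c := 4 * k * ε ^ 2) (b := 0)
    (B := 1) hT le_rfl
    (measurable_inv.mul ((measurable_kernelLoss k ε).mul
      (measurable_boxKernel x x'))).aestronglyMeasurable
    (fun t ht => mul_nonneg (inv_pos.2 ht).le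
      (mul_nonneg (kernelLoss_nonneg k hε ht.le) (boxKernel_nonneg hε hε x x' t)))
    (fun t ht _ => by
      rw [inv_mul_le_iff₀ ht]
      calc kernelLoss k ε t * boxKernel ε x ε x' t ≤ (4 * k * ε ^ 2 * t) * 1 :=
            mul_le_mul (kernelLoss_le k hε ht.le) (boxKernel_le_one hε hε x x' ht.le)
              (boxKernel_nonneg hε hε x x' t) (by positivity)
        _ = t * (4 * k * ε ^ 2) := by ring)
    (fun t h h' => absurd h (not_lt.2 h'))
    (fun t ht => by
      have ht0 : 0 < t := hT.trans ht
      have h3 : t ^ (-2 : ℝ) = t⁻¹ * t⁻¹ := by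
        rw [Real.rpow_neg ht0.le, Real.rpow_two, sq, mul_inv]
      rw [h3, one_mul]
      calc t⁻¹ * (kernelLoss k ε t * boxKernel ε x ε x' t)
          ≤ t⁻¹ * (1 * ((ε ^ 2)⁻¹ * t⁻¹)) := by
            refine mul_le_mul_of_nonneg_left ?_ (inv_pos.2 ht0).le
            exact mul_le_mul (kernelLoss_le_one k hε t) (boxKernel_le_inv hd hε hε x x' ht0)
              (boxKernel_nonneg hε hε x x' t) zero_le_one
        _ = (ε ^ 2)⁻¹ * (t⁻¹ * t⁻¹) := by ring)
  refine ⟨h1, ?_⟩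
  rw [div_self hT.ne', Real.log_one] at h2
  have h3 : 4 * k * ε ^ 2 * (ε ^ 2)⁻¹ = 4 * (k : ℝ) := by field_simp
  unfold lossCov
  linarith

/-! ### Positivity of the lost covariance. -/

section Form

variable {J : Type*} [Fintype J] {x : J → E d}

lemma sum_lossCov (hd : 2 ≤ d) (k : ℕ) (hε : 0 < ε) (c : J → ℝ) :
    ∑ i, ∑ j, c i * c j * lossCov k ε (x i) (x j) =
      1 / 2 * ∫ t in Set.Ioi (0 : ℝ), t⁻¹ * (kernelLoss k ε t * boxForm (fun _ => ε) x c t) := by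
  have h1 : ∀ t, t⁻¹ * (kernelLoss k ε t * boxForm (fun _ => ε) x c t) =
      ∑ i, ∑ j, c i * c j * (t⁻¹ * (kernelLoss k ε t * boxKernel ε (x i) ε (x j) t)) := fun t => by
    simp only [boxForm, Finset.mul_sum]
    exact Finset.sum_congr rfl fun i _ => Finset.sum_congr rfl fun j _ => by ring
  have h2 := fun i j => (lossCov_bound hd k hε (x i) (x j)).1
  simp_rw [h1]
  rw [integral_finsetSum _ fun i _ => integrable_finsetSum _ fun j _ => (h2 i j).const_mul _,
    Finset.mul_sum]
  refine Finset.sum_congr rfl fun i _ => ?_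
  rw [integral_finsetSum _ fun j _ => (h2 i j).const_mul _, Finset.mul_sum]
  refine Finset.sum_congr rfl fun j _ => ?_
  rw [integral_const_mul, lossCov]
  ring

/-- The quadratic form is an integral of the nonnegative Gaussian forms `boxForm` with nonnegative
weights. -/
lemma posSemidef_lossCov (hd : 2 ≤ d) (k : ℕ) (hε : 0 < ε) :
    (Matrix.of fun i j => lossCov k ε (x i) (x j)).PosSemidef := by
  refine Matrix.PosSemidef.of_dotProduct_mulVec_nonneg ?_ fun c => ?_
  · ext i j
    simp only [Matrix.conjTranspose_apply, Matrix.of_apply, star_trivial, lossCov]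
    congr 1
    refine setIntegral_congr_fun measurableSet_Ioi fun t ht => ?_
    rw [boxKernel_comm hε hε _ _ (le_of_lt ht)]
  · have h1 : star c ⬝ᵥ (Matrix.of fun i j => lossCov k ε (x i) (x j)).mulVec c =
        ∑ i, ∑ j, c i * c j * lossCov k ε (x i) (x j) := by
      simp only [dotProduct, Matrix.mulVec, Matrix.of_apply, star_trivial, Pi.star_apply,
        Finset.mul_sum]
      exact Finset.sum_congr rfl fun i _ => Finset.sum_congr rfl fun j _ => by ring
    rw [h1, sum_lossCov hd k hε]
    refine mul_nonneg (by norm_num) (setIntegral_nonneg measurableSet_Ioi fun t ht => ?_)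
    exact mul_nonneg (inv_pos.2 ht).le (mul_nonneg (kernelLoss_nonneg k hε (le_of_lt ht))
      (boxForm_nonneg x c (fun _ => hε) ht))

/-- All added coordinates are zero at both points, so each contributes the same factor, whatever the
points. -/
lemma boxKernel_extend (k : ℕ) (ε t : ℝ) (z w : Fin d → ℤ) :
    boxKernel ε (latticePoint ε (extend k z)) ε (latticePoint ε (extend k w)) t =
      boxKernel ε (latticePoint ε z) ε (latticePoint ε w) t * segKernel ε 0 ε 0 t ^ k := by
  simp [boxKernel, Fin.prod_univ_add, latticePoint_apply, extend]

/-- The variance of a combination of box averages with total weight zero, minus the variance of the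
same combination in dimension `d + k`. -/
lemma boxForm_sub_boxForm_extend (hd : 2 ≤ d) (k : ℕ) (hε : 0 < ε) {z : J → Fin d → ℤ} {c : J → ℝ}
    (hc : ∑ j, c j = 0) :
    (1 / 2 * ∫ t in Set.Ioi (0 : ℝ), t⁻¹ *
        boxForm (fun _ => ε) (fun j => latticePoint ε (z j)) c t) =
      (1 / 2 * ∫ t in Set.Ioi (0 : ℝ), t⁻¹ *
        boxForm (fun _ => ε) (fun j => latticePoint ε (extend k (z j))) c t) +
      ∑ i, ∑ j, c i * c j * lossCov k ε (latticePoint ε (z i)) (latticePoint ε (z j)) := by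
  have h1 := integrableOn_boxForm (ε := fun _ : J => ε) (x := fun j => latticePoint ε (z j))
    (by omega) (fun _ => hε) hc
  have h2 := integrableOn_boxForm (ε := fun _ : J => ε)
    (x := fun j => latticePoint ε (extend k (z j))) (by omega) (fun _ => hε) hc
  rw [sum_lossCov hd k hε (x := fun j => latticePoint ε (z j)), ← mul_add]
  have h3 : ∀ t, t⁻¹ * (kernelLoss k ε t *
      boxForm (fun _ => ε) (fun j => latticePoint ε (z j)) c t) =
      t⁻¹ * boxForm (fun _ => ε) (fun j => latticePoint ε (z j)) c t -
        t⁻¹ * boxForm (fun _ => ε) (fun j => latticePoint ε (extend k (z j))) c t := fun t => by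
    have h4 : boxForm (fun _ => ε) (fun j => latticePoint ε (extend k (z j))) c t =
        boxForm (fun _ => ε) (fun j => latticePoint ε (z j)) c t * segKernel ε 0 ε 0 t ^ k := by
      simp only [boxForm, boxKernel_extend, Finset.sum_mul]
      exact Finset.sum_congr rfl fun i _ => Finset.sum_congr rfl fun j _ => by ring
    rw [h4, kernelLoss]
    ring
  simp_rw [h3]
  rw [integral_sub h1 h2]
  ring

end Form

end KernelEstimates

/-! ### The average over a small box -/

section SmallBox

variable {Ω : Type*} [MeasurableSpace Ω] {d : ℕ} {P : Measure Ω} [IsProbabilityMeasure P]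
  {h : Ω → (𝓢(E d, ℝ) →L[ℝ] ℝ)}

/-- For `t ≤ 1` the two concentric boxes are nearly indistinguishable to the kernel, for `t > ε⁻²`
the kernels decay, and between the form is at most `2`; this middle range produces the logarithm. -/
lemma IsLGF.integral_sq_sub_le (hh : IsLGF P h) (hd : 2 ≤ d) {ε : ℝ} (hε : 0 < ε) (hε1 : ε ≤ 1) :
    ∫ ω, (boxAverage P h ε 0 ω - boxAverage P h 1 0 ω) ^ 2 ∂P ≤
      4 * d + 1 + 2 * Real.log (1 / ε) := by
  have hd1 : 1 ≤ d := by omega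
  set r : Fin 2 → ℝ := ![ε, 1] with hr
  have hr0 : ∀ j, 0 < r j := by simp [Fin.forall_fin_two, hr, hε]
  set c : Fin 2 → ℝ := ![1, -1] with hc
  have hc0 : ∑ j, c j = 0 := by simp [hc]
  have h1 := (hh.combination hd1 (x := fun _ => 0) hr0 hc0).1
  simp only [Fin.sum_univ_two, hc, hr, Matrix.cons_val_zero, Matrix.cons_val_one, one_mul, neg_mul,
    ← sub_eq_add_neg] at h1
  rw [h1]
  have hform : ∀ t, 0 ≤ t → boxForm r (fun _ => (0 : E d)) c t = boxKernel ε (0 : E d) ε 0 t +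
      boxKernel 1 (0 : E d) 1 0 t - 2 * boxKernel ε (0 : E d) 1 0 t := fun t ht => by
    simp only [boxForm, Fin.sum_univ_two, hc, hr, Matrix.cons_val_zero, Matrix.cons_val_one]
    rw [boxKernel_comm one_pos hε (0 : E d) 0 ht]
    ring
  have hnn : ∀ t, 0 ≤ boxKernel ε (0 : E d) 1 0 t := boxKernel_nonneg hε one_pos 0 0
  have hT : 1 ≤ (ε ^ 2)⁻¹ := (one_le_inv₀ (by positivity)).2 (pow_le_one₀ hε.le hε1)
  have h2 := (integrableOn_Ioi_and_integral_le
    (f := fun t => t⁻¹ * boxForm r (fun _ => (0 : E d)) c t)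
    (c := 8 * d) (b := 2) (B := 2) one_pos hT
    (integrableOn_boxForm hd1 hr0 hc0).aestronglyMeasurable
    (fun t ht => mul_nonneg (inv_pos.2 ht).le (boxForm_nonneg _ _ hr0 ht))
    (fun t ht _ => by
      rw [inv_mul_le_iff₀ ht, hform t ht.le]
      have h3 := boxKernel_le_one hε hε (0 : E d) 0 ht.le
      have h4 := boxKernel_le_one one_pos one_pos (0 : E d) 0 ht.le
      have h5 := one_sub_boxKernel_le hε one_pos (0 : E d) ht.le
      have h6 : d * (ε + 1) ^ 2 * t ≤ d * 4 * t := by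
        have : (ε + 1) ^ 2 ≤ 4 := by nlinarith
        gcongr
      linarith)
    (fun t ht _ => by
      have ht0 : 0 < t := one_pos.trans ht
      rw [mul_comm 2, hform t ht0.le]
      refine mul_le_mul_of_nonneg_left ?_ (inv_pos.2 ht0).le
      have h3 := boxKernel_le_one hε hε (0 : E d) 0 ht0.le
      have h4 := boxKernel_le_one one_pos one_pos (0 : E d) 0 ht0.le
      linarith [hnn t])
    (fun t ht => by
      have ht0 : 0 < t := (one_pos.trans_le hT).trans ht
      have h7 : t ^ (-2 : ℝ) = t⁻¹ * t⁻¹ := by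
        rw [Real.rpow_neg ht0.le, Real.rpow_two, sq, mul_inv]
      rw [h7, hform t ht0.le, mul_comm (2 * (ε ^ 2)⁻¹), mul_assoc]
      refine mul_le_mul_of_nonneg_left ?_ (inv_pos.2 ht0).le
      have h3 := boxKernel_le_inv hd hε hε (0 : E d) 0 ht0
      have h4 := boxKernel_le_inv hd one_pos one_pos (0 : E d) 0 ht0
      have h5 : ((1 : ℝ) ^ 2)⁻¹ * t⁻¹ ≤ (ε ^ 2)⁻¹ * t⁻¹ := by
        have := (inv_pos.2 ht0).le
        gcongr
      linarith [hnn t])).2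
  have h8 : Real.log ((ε ^ 2)⁻¹ / 1) = 2 * Real.log (1 / ε) := by
    rw [div_one, Real.log_inv, Real.log_pow, one_div, Real.log_inv]
    push_cast
    ring
  rw [h8] at h2
  linarith

/-- A single box average is not a combination of weight zero, so it is compared with the average
over the unit-scale box, of which only a finite second moment is needed. -/
lemma IsLGF.exists_integral_sq_le (hh : IsLGF P h) (hd : 2 ≤ d) :
    ∃ A : ℝ, ∀ ε : ℝ, 0 < ε → ε ≤ 1 →
      ∫ ω, boxAverage P h ε 0 ω ^ 2 ∂P ≤ A + 4 * Real.log (1 / ε) := by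
  have hd1 : 1 ≤ d := by omega
  refine ⟨2 * (4 * d + 1) + 2 * ∫ ω, boxAverage P h 1 0 ω ^ 2 ∂P, fun ε hε hε1 => ?_⟩
  have h1 := hh.memLp_boxAverage hd1 hε (0 : E d)
  have h2 := hh.memLp_boxAverage hd1 one_pos (0 : E d)
  have h3 := (h1.sub h2).integrable_sq
  simp only [Pi.sub_apply] at h3
  calc ∫ ω, boxAverage P h ε 0 ω ^ 2 ∂P
      ≤ ∫ ω, (2 * (boxAverage P h ε 0 ω - boxAverage P h 1 0 ω) ^ 2 +
          2 * boxAverage P h 1 0 ω ^ 2) ∂P := by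
        refine integral_mono h1.integrable_sq ((h3.const_mul 2).add (h2.integrable_sq.const_mul 2))
          fun ω => ?_
        simp only
        nlinarith [sq_nonneg (boxAverage P h ε 0 ω - 2 * boxAverage P h 1 0 ω)]
    _ = 2 * ∫ ω, (boxAverage P h ε 0 ω - boxAverage P h 1 0 ω) ^ 2 ∂P +
          2 * ∫ ω, boxAverage P h 1 0 ω ^ 2 ∂P := by
        rw [integral_add (h3.const_mul 2) (h2.integrable_sq.const_mul 2), integral_const_mul,
          integral_const_mul]
    _ ≤ _ := by
        have := hh.integral_sq_sub_le hd hε hε1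
        linarith

end SmallBox

/-! ### Gaussian comparison modulo constants -/

section Comparison

variable {ι : Type*} [Fintype ι]

/-- Subtract the value at `i₀` from all coordinates. -/
noncomputable def subCoord (i₀ : ι) : EuclideanSpace ℝ ι →L[ℝ] EuclideanSpace ℝ ι :=
  LinearMap.toContinuousLinearMap
    { toFun := fun v => WithLp.toLp 2 fun i => v i - v i₀
      map_add' := fun v w => by ext i; simp; ring
      map_smul' := fun a v => by ext i; simp; ring }

@[simp] lemma subCoord_apply (i₀ : ι) (v : EuclideanSpace ℝ ι) (i : ι) :
    subCoord i₀ v i = v i - v i₀ := rfl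

/-- The range of the adjoint is orthogonal to the constants, which `subCoord` kills. Thus
characteristic functions after `subCoord` only see weights of sum zero. -/
lemma sum_adjoint_subCoord (i₀ : ι) (v : EuclideanSpace ℝ ι) :
    ∑ i, ContinuousLinearMap.adjoint (subCoord i₀) v i = 0 := by
  have h1 := ContinuousLinearMap.adjoint_inner_right (subCoord i₀)
    (WithLp.toLp 2 fun _ => (1 : ℝ)) v
  have h2 : subCoord i₀ (WithLp.toLp 2 fun _ => (1 : ℝ)) = 0 := by ext i; simp
  rw [h2, inner_zero_left] at h1
  simpa [PiLp.inner_apply] using h1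

lemma charFun_map_subCoord (μ : Measure (EuclideanSpace ℝ ι)) (i₀ : ι) (v : EuclideanSpace ℝ ι) :
    charFun (μ.map (subCoord i₀)) v =
      charFun μ (ContinuousLinearMap.adjoint (subCoord i₀) v) := by
  rw [charFun_apply, charFun_apply, integral_map (by fun_prop)
    (Continuous.aestronglyMeasurable (by fun_prop))]
  simp_rw [ContinuousLinearMap.adjoint_inner_right]

/-- Two probability measures whose characteristic functions agree on the hyperplane of vectors of
sum zero agree modulo constants. -/
lemma map_subCoord_eq {μ ν : Measure (EuclideanSpace ℝ ι)} [IsProbabilityMeasure μ]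
    [IsProbabilityMeasure ν] (h : ∀ c : EuclideanSpace ℝ ι, ∑ i, c i = 0 → charFun μ c = charFun ν c)
    (i₀ : ι) : μ.map (subCoord i₀) = ν.map (subCoord i₀) := by
  have h1 : IsProbabilityMeasure (μ.map (subCoord i₀)) :=
    Measure.isProbabilityMeasure_map (by fun_prop)
  have h2 : IsProbabilityMeasure (ν.map (subCoord i₀)) :=
    Measure.isProbabilityMeasure_map (by fun_prop)
  refine Measure.ext_of_charFun (funext fun v => ?_)
  rw [charFun_map_subCoord, charFun_map_subCoord, h _ (sum_adjoint_subCoord i₀ v)]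

lemma charFun_map_toLp {Ω : Type*} [MeasurableSpace Ω] {P : Measure Ω} {X : ι → Ω → ℝ}
    (hX : ∀ i, AEMeasurable (X i) P) (c : EuclideanSpace ℝ ι) :
    charFun (P.map fun ω => WithLp.toLp 2 fun i => X i ω) c =
      ∫ ω, Complex.exp ((∑ i, c i * X i ω : ℝ) * Complex.I) ∂P := by
  have hm : AEMeasurable (fun ω => (WithLp.toLp 2 fun i => X i ω : EuclideanSpace ℝ ι)) P :=
    (PiLp.continuous_toLp 2 _).measurable.comp_aemeasurable (aemeasurable_pi_lambda _ hX)
  rw [charFun_apply, integral_map hm (Continuous.aestronglyMeasurable (by fun_prop))]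
  simp [PiLp.inner_apply]

end Comparison

/-! ### The laws of the two fields on lattice points, modulo constants. -/

section LatticeComparison

variable {Ω Ω' : Type*} [MeasurableSpace Ω] [MeasurableSpace Ω'] {d k : ℕ}
  {P : Measure Ω} {P' : Measure Ω'}
  {h : Ω → (𝓢(E d, ℝ) →L[ℝ] ℝ)} {h' : Ω' → (𝓢(E (d + k), ℝ) →L[ℝ] ℝ)}
  {I : Finset (Fin d → ℤ)}

/-- The box averages at the lattice points `ε z` for `z` in a finite set. -/
noncomputable def fieldVec (P : Measure Ω) (h : Ω → (𝓢(E d, ℝ) →L[ℝ] ℝ)) (ε : ℝ)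
    (I : Finset (Fin d → ℤ)) (ω : Ω) : EuclideanSpace ℝ I :=
  WithLp.toLp 2 fun z => boxAverage P h ε (latticePoint ε z.1) ω

/-- The box averages at the lattice points `ε (z, 0)` for `z` in a finite set. -/
noncomputable def sectionVec (P' : Measure Ω') (h' : Ω' → (𝓢(E (d + k), ℝ) →L[ℝ] ℝ)) (ε : ℝ)
    (I : Finset (Fin d → ℤ)) (ω : Ω') : EuclideanSpace ℝ I :=
  WithLp.toLp 2 fun z => boxAverage P' h' ε (latticePoint ε (extend k z.1)) ω

/-- The law of a centered Gaussian vector with covariance `lossCov`. -/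
noncomputable def lossMeasure (k : ℕ) (ε : ℝ) (I : Finset (Fin d → ℤ)) :
    Measure (EuclideanSpace ℝ I) :=
  multivariateGaussian 0
    (Matrix.of fun z w : I => lossCov k ε (latticePoint ε z.1) (latticePoint ε w.1))

instance (ε : ℝ) : IsProbabilityMeasure (lossMeasure k ε I) := by
  unfold lossMeasure; infer_instance

lemma aemeasurable_fieldVec (hh : IsLGF P h) (hd : 1 ≤ d) {ε : ℝ} (hε : 0 < ε) :
    AEMeasurable (fieldVec P h ε I) P :=
  (PiLp.continuous_toLp 2 _).measurable.comp_aemeasurable (aemeasurable_pi_lambda _ fun z =>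
    (hh.memLp_boxAverage hd hε (latticePoint ε z.1)).aestronglyMeasurable.aemeasurable)

lemma aemeasurable_sectionVec (hh' : IsLGF P' h') (hd : 1 ≤ d) {ε : ℝ} (hε : 0 < ε) :
    AEMeasurable (sectionVec P' h' ε I) P' :=
  (PiLp.continuous_toLp 2 _).measurable.comp_aemeasurable (aemeasurable_pi_lambda _ fun z =>
    (hh'.memLp_boxAverage (by omega) hε
      (latticePoint ε (extend k z.1))).aestronglyMeasurable.aemeasurable)

lemma charFun_fieldVec [IsProbabilityMeasure P] (hh : IsLGF P h) (hd : 1 ≤ d) {ε : ℝ}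
    (hε : 0 < ε) {c : EuclideanSpace ℝ I} (hc : ∑ z, c z = 0) :
    charFun (P.map (fieldVec P h ε I)) c =
      Complex.exp (-((1 / 2 * ∫ t in Set.Ioi (0 : ℝ), t⁻¹ *
        boxForm (fun _ => ε) (fun z : I => latticePoint ε z.1) c t) / 2 : ℝ)) := by
  unfold fieldVec
  rw [charFun_map_toLp (X := fun z : I => boxAverage P h ε (latticePoint ε z.1)) fun z =>
    (hh.memLp_boxAverage hd hε _).aestronglyMeasurable.aemeasurable]
  exact (hh.combination hd (ε := fun _ : I => ε) (x := fun z : I => latticePoint ε z.1)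
    (fun _ => hε) hc).2

lemma charFun_sectionVec [IsProbabilityMeasure P'] (hh' : IsLGF P' h') (hd : 1 ≤ d) {ε : ℝ}
    (hε : 0 < ε) {c : EuclideanSpace ℝ I} (hc : ∑ z, c z = 0) :
    charFun (P'.map (sectionVec P' h' ε I)) c =
      Complex.exp (-((1 / 2 * ∫ t in Set.Ioi (0 : ℝ), t⁻¹ *
        boxForm (fun _ => ε) (fun z : I => latticePoint ε (extend k z.1)) c t) / 2 : ℝ)) := by
  unfold sectionVec
  have hd' : 1 ≤ d + k := by omega
  rw [charFun_map_toLp (X := fun z : I => boxAverage P' h' ε (latticePoint ε (extend k z.1)))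
    fun z => (hh'.memLp_boxAverage hd' hε _).aestronglyMeasurable.aemeasurable]
  exact (hh'.combination hd' (ε := fun _ : I => ε)
    (x := fun z : I => latticePoint ε (extend k z.1)) (fun _ => hε) hc).2

lemma charFun_lossMeasure (hd : 2 ≤ d) {ε : ℝ} (hε : 0 < ε) (c : EuclideanSpace ℝ I) :
    charFun (lossMeasure k ε I) c = Complex.exp (-((∑ i : I, ∑ j : I, c i * c j *
      lossCov k ε (latticePoint ε i.1) (latticePoint ε j.1)) / 2 : ℝ)) := by
  rw [lossMeasure, charFun_multivariateGaussian
    (posSemidef_lossCov (x := fun z : I => latticePoint ε z.1) hd k hε)]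
  have h5 : c.ofLp ⬝ᵥ (Matrix.of fun z w : I =>
      lossCov k ε (latticePoint ε z.1) (latticePoint ε w.1)).mulVec c.ofLp =
      ∑ i : I, ∑ j : I, c i * c j * lossCov k ε (latticePoint ε i.1) (latticePoint ε j.1) := by
    simp only [dotProduct, Matrix.mulVec, Matrix.of_apply, Finset.mul_sum]
    exact Finset.sum_congr rfl fun i _ => Finset.sum_congr rfl fun j _ => by ring
  rw [h5, inner_zero_right, Complex.ofReal_zero, zero_mul, zero_sub]
  push_cast
  rfl

/-- Modulo constants, the field in dimension `d` is the section of the field in dimension `d + k`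
plus an independent Gaussian vector. -/
theorem map_subCoord_fieldVec [IsProbabilityMeasure P] [IsProbabilityMeasure P'] (hh : IsLGF P h)
    (hh' : IsLGF P' h') (hd : 2 ≤ d) {ε : ℝ} (hε : 0 < ε) (z₀ : I) :
    (P.map (fieldVec P h ε I)).map (subCoord z₀) =
      (((P'.map (sectionVec P' h' ε I)).prod (lossMeasure k ε I)).map
        (fun p => p.1 + p.2)).map (subCoord z₀) := by
  have hd1 : 1 ≤ d := by omega
  have i1 : IsProbabilityMeasure (P.map (fieldVec P h ε I)) :=
    Measure.isProbabilityMeasure_map (aemeasurable_fieldVec hh hd1 hε)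
  have i2 : IsProbabilityMeasure (P'.map (sectionVec P' h' ε I)) :=
    Measure.isProbabilityMeasure_map (aemeasurable_sectionVec hh' hd1 hε)
  have i3 : IsProbabilityMeasure (((P'.map (sectionVec P' h' ε I)).prod (lossMeasure k ε I)).map
        (fun p => p.1 + p.2)) := Measure.isProbabilityMeasure_map (by fun_prop)
  refine map_subCoord_eq (fun c hc => ?_) z₀
  rw [charFun_map_add_prod_eq_mul, Pi.mul_apply, charFun_fieldVec hh hd1 hε hc,
    charFun_sectionVec hh' hd1 hε hc, charFun_lossMeasure hd hε, ← Complex.exp_add,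
    boxForm_sub_boxForm_extend hd k hε (z := fun z : I => z.1) hc]
  congr 1
  push_cast
  ring

/-- Gaussian tail bound for the coordinates of `lossMeasure`. -/
lemma lossMeasure_coord_le (hd : 2 ≤ d) {ε : ℝ} (hε : 0 < ε) (z : I) (a : ℝ) {s u : ℝ}
    (hs : 0 ≤ s) :
    (lossMeasure k ε I).real {v | u ≤ a * v z} ≤
      Real.exp (-s * u) * Real.exp ((2 * k + 1) * (a * s) ^ 2 / 2) := by
  have hmap := (measurePreserving_eval_multivariateGaussian
    (μ := (0 : EuclideanSpace ℝ I)) (posSemidef_lossCov (x := fun z : I => latticePoint ε z.1)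
      hd k hε) (i := z)).map_eq
  have hint : Integrable (fun v : EuclideanSpace ℝ I => Real.exp (s * (a * v z)))
      (lossMeasure k ε I) := by
    have h1 : Integrable (fun x => Real.exp (s * a * x)) ((lossMeasure k ε I).map (fun v => v z)) := by
      unfold lossMeasure
      rw [hmap]
      exact integrable_exp_mul_gaussianReal _
    have h2 := h1.comp_measurable (by fun_prop)
    simpa only [Function.comp_def, mul_assoc] using h2
  refine (measure_ge_le_exp_mul_mgf u hs hint).trans ?_
  refine mul_le_mul_of_nonneg_left ?_ (Real.exp_pos _).le
  rw [mgf_const_mul, lossMeasure, mgf_gaussianReal hmap]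
  refine Real.exp_le_exp.2 ?_
  have h3 : ((lossCov k ε (latticePoint ε z.1) (latticePoint ε z.1)).toNNReal : ℝ) ≤ 2 * k + 1 := by
    rw [Real.coe_toNNReal']
    exact max_le (lossCov_bound hd k hε _ _).2 (by positivity)
  simp only [Matrix.of_apply, PiLp.zero_apply, zero_mul, zero_add]
  gcongr

/-- Union bound over the points and the two signs. The parameter `s` stays free so that it can later
be chosen to beat the number of points. -/
lemma lossMeasure_exists_le (hd : 2 ≤ d) {ε : ℝ} (hε : 0 < ε) {ξ s u : ℝ}
    (hs : 0 ≤ s) :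
    (lossMeasure k ε I).real {v | ∃ z, u ≤ ξ * |v z|} ≤
      I.card * (2 * (Real.exp (-s * u) * Real.exp ((2 * k + 1) * (ξ * s) ^ 2 / 2))) := by
  have h1 : {v : EuclideanSpace ℝ I | ∃ z, u ≤ ξ * |v z|} ⊆
      ⋃ z : I, ({v | u ≤ ξ * v z} ∪ {v | u ≤ (-ξ) * v z}) := by
    rintro v ⟨z, hz⟩
    refine Set.mem_iUnion.2 ⟨z, ?_⟩
    rcases abs_cases (v z) with ⟨h, -⟩ | ⟨h, -⟩
    · left; rwa [h] at hz
    · right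
      rw [h] at hz
      show u ≤ (-ξ) * v z
      linarith
  refine (measureReal_mono h1).trans ((measureReal_iUnion_fintype_le _).trans ?_)
  calc ∑ z : I, (lossMeasure k ε I).real ({v | u ≤ ξ * v z} ∪ {v | u ≤ (-ξ) * v z})
      ≤ ∑ _z : I, 2 * (Real.exp (-s * u) * Real.exp ((2 * k + 1) * (ξ * s) ^ 2 / 2)) := by
        refine Finset.sum_le_sum fun z _ => (measureReal_union_le _ _).trans ?_
        have h2 := lossMeasure_coord_le (k := k) hd hε z ξ (u := u) hs
        have h3 := lossMeasure_coord_le (k := k) hd hε z (-ξ) (u := u) hs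
        have h4 : (-ξ * s) ^ 2 = (ξ * s) ^ 2 := by ring
        rw [h4] at h3
        linarith
    _ = _ := by simp

end LatticeComparison

/-! ### Comparison of crossing distances -/

section Crossing

variable {d k : ℕ}

/-- The crossing distance of the lattice cube at scale `1/(n+1)` for the field with values `v`. -/
noncomputable def vecDist (n : ℕ) (ξ : ℝ) (v : EuclideanSpace ℝ (cubeFinset d n)) : ℝ≥0∞ :=
  setDist (1 / ((n : ℝ) + 1)) ξ (fun z => if hz : z ∈ cubeFinset d n then v ⟨z, hz⟩ else 0)
    (cube d (1 / ((n : ℝ) + 1))) (face d (1 / ((n : ℝ) + 1)) 0) (face d (1 / ((n : ℝ) + 1)) 1)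

lemma measurable_vecDist (n : ℕ) (ξ : ℝ) : Measurable (vecDist (d := d) n ξ) := by
  refine measurable_setDist _ _ (fun z => ?_) _ _ _
  by_cases hz : z ∈ cubeFinset d n
  · simp only [dif_pos hz]
    fun_prop
  · simp only [dif_neg hz]
    fun_prop

lemma one_div_succ_pos (n : ℕ) : (0 : ℝ) < 1 / ((n : ℝ) + 1) := by positivity

lemma vecDist_le_of_forall_le {n : ℕ} {ξ s : ℝ} {v w : EuclideanSpace ℝ (cubeFinset d n)}
    (h : ∀ z, ξ * v z ≤ s + ξ * w z) :
    vecDist n ξ v ≤ ENNReal.ofReal (Real.exp s) * vecDist n ξ w := by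
  refine setDist_le_mul (one_div_succ_pos n).le (fun z hz => ?_) _ _
  have hz' := mem_cubeFinset_of_mem_cube hz
  simp only [dif_pos hz']
  exact h ⟨z, hz'⟩

lemma vecDist_le_rpow {n : ℕ} {ξ δ a m : ℝ} {v w : EuclideanSpace ℝ (cubeFinset d n)}
    (hw : vecDist n ξ w ≤ ENNReal.ofReal ((1 / ((n : ℝ) + 1)) ^ a))
    (h : ∀ z, ξ * v z ≤ m * (δ * Real.log (n + 1)) + ξ * w z) :
    vecDist n ξ v ≤ ENNReal.ofReal ((1 / ((n : ℝ) + 1)) ^ (a - m * δ)) := by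
  have hn : (0 : ℝ) < n + 1 := by positivity
  refine (vecDist_le_of_forall_le h).trans ((mul_le_mul_right hw _).trans ?_)
  rw [← ENNReal.ofReal_mul (Real.exp_pos _).le]
  refine ENNReal.ofReal_le_ofReal (le_of_eq ?_)
  rw [Real.rpow_def_of_pos (one_div_succ_pos n), Real.rpow_def_of_pos (one_div_succ_pos n),
    ← Real.exp_add, one_div, Real.log_inv]
  ring_nf

variable {Ω Ω' : Type*} [MeasurableSpace Ω] [MeasurableSpace Ω']
  {P : Measure Ω} {P' : Measure Ω'}
  {h : Ω → (𝓢(E d, ℝ) →L[ℝ] ℝ)} {h' : Ω' → (𝓢(E (d + k), ℝ) →L[ℝ] ℝ)}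

/-- Paths stay in the cube, so the value `0` assigned off `cubeFinset` in `vecDist` is never used.
-/
lemma crossingDist_eq_vecDist (n : ℕ) (ξ : ℝ) (ω : Ω) :
    crossingDist P h (1 / ((n : ℝ) + 1)) ξ ω =
      vecDist n ξ (fieldVec P h (1 / ((n : ℝ) + 1)) (cubeFinset d n) ω) := by
  refine setDist_congr (one_div_succ_pos n).le (fun z hz => ?_) _ _
  simp only [dif_pos (mem_cubeFinset_of_mem_cube hz)]
  rfl

lemma crossingDist_le_vecDist (hd : 1 ≤ d) (n : ℕ) (ξ : ℝ) (ω : Ω') :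
    crossingDist P' h' (1 / ((n : ℝ) + 1)) ξ ω ≤
      vecDist n ξ (sectionVec P' h' (1 / ((n : ℝ) + 1)) (cubeFinset d n) ω) := by
  refine (setDist_cube_extend_le hd _ ξ _).trans (le_of_eq ?_)
  refine setDist_congr (one_div_succ_pos n).le (fun z hz => ?_) _ _
  simp only [dif_pos (mem_cubeFinset_of_mem_cube hz)]
  rfl

lemma latticePoint_zero (ε : ℝ) : latticePoint (d := d) ε 0 = 0 := by
  ext i; simp [latticePoint_apply]

lemma extend_zero : extend k (0 : Fin d → ℤ) = 0 := by
  ext i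
  refine Fin.addCases (fun j => ?_) (fun j => ?_) i <;> simp [extend]

/-- The origin as a point of the lattice cube. -/
noncomputable def cubeOrigin (d n : ℕ) : cubeFinset d n := ⟨0, zero_mem_cubeFinset d n⟩

lemma fieldVec_cubeOrigin (n : ℕ) (ε : ℝ) (ω : Ω) :
    fieldVec P h ε (cubeFinset d n) ω (cubeOrigin d n) = boxAverage P h ε 0 ω := by
  simp [fieldVec, cubeOrigin, latticePoint_zero]

lemma sectionVec_cubeOrigin (n : ℕ) (ε : ℝ) (ω : Ω') :
    sectionVec P' h' ε (cubeFinset d n) ω (cubeOrigin d n) = boxAverage P' h' ε 0 ω := by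
  simp [sectionVec, cubeOrigin, extend_zero, latticePoint_zero]

/-- Off the three exceptional events every correction is at most `δ log (n + 1)` after
multiplication by `ξ`. One correction removes the origin value in dimension `d`; three more recover
the section. -/
lemma measure_crossingDist_le [IsProbabilityMeasure P] [IsProbabilityMeasure P']
    (hh : IsLGF P h) (hh' : IsLGF P' h') (hd : 2 ≤ d) {ξ : ℝ} (hξ : 0 ≤ ξ) (n : ℕ) (a δ : ℝ) :
    P {ω | crossingDist P h (1 / ((n : ℝ) + 1)) ξ ω ≤ ENNReal.ofReal ((1 / ((n : ℝ) + 1)) ^ a)} ≤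
      P' {ω | crossingDist P' h' (1 / ((n : ℝ) + 1)) ξ ω ≤
        ENNReal.ofReal ((1 / ((n : ℝ) + 1)) ^ (a - 4 * δ))} +
      (P {ω | δ * Real.log (n + 1) ≤ ξ * |boxAverage P h (1 / ((n : ℝ) + 1)) 0 ω|} +
      P' {ω | δ * Real.log (n + 1) ≤ ξ * |boxAverage P' h' (1 / ((n : ℝ) + 1)) 0 ω|} +
      lossMeasure k (1 / ((n : ℝ) + 1)) (cubeFinset d n)
        {v | ∃ z, δ * Real.log (n + 1) ≤ ξ * |v z|}) := by
  set ε : ℝ := 1 / ((n : ℝ) + 1) with hεdef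
  have hε : 0 < ε := one_div_succ_pos n
  have hd1 : 1 ≤ d := by omega
  set u := δ * Real.log (n + 1) with hu
  set I := cubeFinset d n
  set z₀ := cubeOrigin d n with hz₀
  set γ := lossMeasure k ε I
  set A : ℝ → Set (EuclideanSpace ℝ I) :=
    fun b => {v | vecDist n ξ v ≤ ENNReal.ofReal (ε ^ b)} with hA
  have hAmeas : ∀ b, MeasurableSet (A b) := fun b =>
    measurableSet_le (measurable_vecDist n ξ) measurable_const
  have hX := aemeasurable_fieldVec (I := I) hh hd1 hε
  have hX' := aemeasurable_sectionVec (I := I) hh' hd1 hε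
  have i2 : IsProbabilityMeasure (P'.map (sectionVec P' h' ε I)) :=
    Measure.isProbabilityMeasure_map hX'
  have habs : ∀ x : ℝ, -(ξ * |x|) ≤ ξ * x ∧ ξ * x ≤ ξ * |x| := fun x =>
    ⟨by nlinarith [neg_abs_le x], mul_le_mul_of_nonneg_left (le_abs_self x) hξ⟩
  have s1 : P {ω | crossingDist P h ε ξ ω ≤ ENNReal.ofReal (ε ^ a)} ≤
      P {ω | subCoord z₀ (fieldVec P h ε I ω) ∈ A (a - δ)} +
        P {ω | u ≤ ξ * |boxAverage P h ε 0 ω|} := by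
    refine (measure_mono fun ω hω => ?_).trans (measure_union_le _ _)
    rcases le_or_gt u (ξ * |boxAverage P h ε 0 ω|) with h1 | h1
    · exact Or.inr h1
    · left
      have h2 : vecDist n ξ (fieldVec P h ε I ω) ≤ ENNReal.ofReal (ε ^ a) := by
        rw [← crossingDist_eq_vecDist]; exact hω
      have h3 := vecDist_le_rpow (m := 1) (δ := δ) (v := subCoord z₀ (fieldVec P h ε I ω)) h2
        fun z => by
          rw [subCoord_apply, fieldVec_cubeOrigin]
          have h4 := (habs (boxAverage P h ε 0 ω)).1
          linarith
      rwa [one_mul] at h3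
  have s2 : P {ω | subCoord z₀ (fieldVec P h ε I ω) ∈ A (a - δ)} =
      ((P'.map (sectionVec P' h' ε I)).prod γ) {p | subCoord z₀ (p.1 + p.2) ∈ A (a - δ)} := by
    have hT : Measurable (subCoord z₀) := (subCoord z₀).continuous.measurable
    have h1 := congrArg (fun μ => μ (A (a - δ)))
      (map_subCoord_fieldVec (k := k) hh hh' hd hε z₀)
    rw [Measure.map_apply hT (hAmeas _), Measure.map_apply hT (hAmeas _),
      Measure.map_apply_of_aemeasurable hX (hT (hAmeas _)),
      Measure.map_apply (by fun_prop) (hT (hAmeas _))] at h1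
    exact h1
  have s3 : ((P'.map (sectionVec P' h' ε I)).prod γ)
      {p | subCoord z₀ (p.1 + p.2) ∈ A (a - δ)} ≤
      (P'.map (sectionVec P' h' ε I)) (A (a - 4 * δ)) +
      ((P'.map (sectionVec P' h' ε I)) {v | u ≤ ξ * |v z₀|} + γ {v | ∃ z, u ≤ ξ * |v z|}) := by
    have hsub : {p : EuclideanSpace ℝ I × EuclideanSpace ℝ I |
        subCoord z₀ (p.1 + p.2) ∈ A (a - δ)} ⊆ (A (a - 4 * δ) ×ˢ Set.univ) ∪
          (({v | u ≤ ξ * |v z₀|} ×ˢ Set.univ) ∪ (Set.univ ×ˢ {v | ∃ z, u ≤ ξ * |v z|})) := by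
      rintro ⟨v, y⟩ hp
      by_cases h1 : u ≤ ξ * |v z₀|
      · exact Or.inr (Or.inl ⟨h1, trivial⟩)
      by_cases h2 : ∃ z, u ≤ ξ * |y z|
      · exact Or.inr (Or.inr ⟨trivial, h2⟩)
      left
      refine ⟨?_, trivial⟩
      push Not at h1 h2
      -- The three errors are `v z₀`, `y z` and `y z₀`: the value `v z` is that of `subCoord z₀ (v +
      -- y)` at `z`, minus `y z`, plus `y z₀` and `v z₀`.
      have h3 := vecDist_le_rpow (m := 3) (δ := δ) (v := v) hp fun z => by
        rw [subCoord_apply, PiLp.add_apply, PiLp.add_apply]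
        have e1 := (habs (v z₀)).2
        have e2 := (habs (y z)).1
        have e3 := (habs (y z₀)).2
        have e4 := h2 z
        have e5 := h2 z₀
        linarith
      have h4 : a - δ - 3 * δ = a - 4 * δ := by ring
      rwa [h4] at h3
    refine (measure_mono hsub).trans ((measure_union_le _ _).trans
      (add_le_add ?_ ((measure_union_le _ _).trans (add_le_add ?_ ?_))))
    all_goals simp [Measure.prod_prod]
  have s4 : (P'.map (sectionVec P' h' ε I)) (A (a - 4 * δ)) ≤
      P' {ω | crossingDist P' h' ε ξ ω ≤ ENNReal.ofReal (ε ^ (a - 4 * δ))} := by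
    rw [Measure.map_apply_of_aemeasurable hX' (hAmeas _)]
    exact measure_mono fun ω hω => (crossingDist_le_vecDist hd1 n ξ ω).trans hω
  have s5 : (P'.map (sectionVec P' h' ε I)) {v | u ≤ ξ * |v z₀|} =
      P' {ω | u ≤ ξ * |boxAverage P' h' ε 0 ω|} := by
    rw [Measure.map_apply_of_aemeasurable hX'
      (measurableSet_le measurable_const (by fun_prop))]
    simp only [Set.preimage_ofPred_eq, hz₀, I, sectionVec_cubeOrigin]
  calc _ ≤ _ := s1
    _ ≤ _ := add_le_add_left (s2.le.trans (s3.trans (add_le_add_left s4 _))) _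
    _ = _ := by rw [s5]; ring

end Crossing

/-! ### Convergence of the error terms -/

section Errors

lemma tendsto_log_succ : Tendsto (fun n : ℕ => Real.log ((n : ℝ) + 1)) atTop atTop :=
  Real.tendsto_log_atTop.comp (tendsto_atTop_add_const_right _ _ tendsto_natCast_atTop_atTop)

variable {d : ℕ}

/-- Chebyshev: a second moment of order `log (n + 1)` against the square of a threshold of order
`log (n + 1)`. -/
lemma tendsto_measure_origin {Ω : Type*} [MeasurableSpace Ω] {P : Measure Ω}
    [IsProbabilityMeasure P] {h : Ω → (𝓢(E d, ℝ) →L[ℝ] ℝ)} (hh : IsLGF P h) (hd : 2 ≤ d)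
    {ξ δ : ℝ} (hδ : 0 < δ) :
    Tendsto (fun n : ℕ => P {ω | δ * Real.log (n + 1) ≤
      ξ * |boxAverage P h (1 / ((n : ℝ) + 1)) 0 ω|}) atTop (𝓝 0) := by
  obtain ⟨A, hA⟩ := hh.exists_integral_sq_le hd
  have hlim : Tendsto (fun n : ℕ => ξ ^ 2 / δ ^ 2 * (A * (Real.log ((n : ℝ) + 1))⁻¹ ^ 2 +
      4 * (Real.log ((n : ℝ) + 1))⁻¹)) atTop (𝓝 0) := by
    have h1 := tendsto_log_succ.inv_tendsto_atTop
    simpa using (((h1.pow 2).const_mul A).add (h1.const_mul 4)).const_mul (ξ ^ 2 / δ ^ 2)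
  have hlim' := ENNReal.tendsto_ofReal hlim
  rw [ENNReal.ofReal_zero] at hlim'
  refine tendsto_of_tendsto_of_tendsto_of_le_of_le' tendsto_const_nhds hlim'
    (Eventually.of_forall fun _ => zero_le) ?_
  filter_upwards [tendsto_log_succ.eventually_gt_atTop 0] with n hn
  set L := Real.log ((n : ℝ) + 1) with hL
  have hε := one_div_succ_pos n
  have hε1 : 1 / ((n : ℝ) + 1) ≤ 1 := by
    rw [div_le_one (by positivity)]; linarith [Nat.cast_nonneg (α := ℝ) n]
  have h1 := hA _ hε hε1
  rw [one_div_one_div] at h1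
  have hmem := hh.memLp_boxAverage (by omega) hε (0 : E d)
  rw [← ofReal_measureReal]
  refine ENNReal.ofReal_le_ofReal ?_
  have h2 := mul_meas_ge_le_integral_of_nonneg (μ := P)
    (f := fun ω => ξ ^ 2 * boxAverage P h (1 / ((n : ℝ) + 1)) 0 ω ^ 2)
    (ae_of_all _ fun ω => by positivity) (hmem.integrable_sq.const_mul _) ((δ * L) ^ 2)
  rw [integral_const_mul] at h2
  have h3 : P.real {ω | δ * L ≤ ξ * |boxAverage P h (1 / ((n : ℝ) + 1)) 0 ω|} ≤
      P.real {ω | (δ * L) ^ 2 ≤ ξ ^ 2 * boxAverage P h (1 / ((n : ℝ) + 1)) 0 ω ^ 2} := by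
    refine measureReal_mono fun ω hω => ?_
    have h4 : (δ * L) ^ 2 ≤ (ξ * |boxAverage P h (1 / ((n : ℝ) + 1)) 0 ω|) ^ 2 :=
      pow_le_pow_left₀ (by positivity) hω 2
    rwa [mul_pow ξ, sq_abs] at h4
  have h5 : (δ * L) ^ 2 * P.real {ω | δ * L ≤ ξ * |boxAverage P h (1 / ((n : ℝ) + 1)) 0 ω|} ≤
      ξ ^ 2 * (A + 4 * L) :=
    (mul_le_mul_of_nonneg_left h3 (sq_nonneg _)).trans
      (h2.trans (mul_le_mul_of_nonneg_left h1 (sq_nonneg _)))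
  have h6 : ξ ^ 2 / δ ^ 2 * (A * L⁻¹ ^ 2 + 4 * L⁻¹) = ξ ^ 2 * (A + 4 * L) / (δ * L) ^ 2 := by
    field_simp
  rw [h6, le_div_iff₀ (by positivity), mul_comm]
  exact h5

lemma tendsto_lossMeasure (k : ℕ) (hd : 2 ≤ d) {ξ δ : ℝ} (hδ : 0 < δ) :
    Tendsto (fun n : ℕ => lossMeasure k (1 / ((n : ℝ) + 1)) (cubeFinset d n)
      {v | ∃ z, δ * Real.log (n + 1) ≤ ξ * |v z|}) atTop (𝓝 0) := by
  -- This choice turns the Chernoff factor into `(n + 1) ^ (-(d + 1))`, one power more than the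
  -- number of lattice points, while the other factor `K` stays independent of `n`.
  set s := (d + 1) / δ with hs
  have hs0 : 0 ≤ s := by positivity
  set K := Real.exp ((2 * k + 1) * (ξ * s) ^ 2 / 2) with hK
  have hlim : Tendsto (fun n : ℕ => 2 ^ d * (2 * K) * (1 / ((n : ℝ) + 1))) atTop (𝓝 0) := by
    simpa using tendsto_one_div_add_atTop_nhds_zero_nat.const_mul (2 ^ d * (2 * K))
  have hlim' := ENNReal.tendsto_ofReal hlim
  rw [ENNReal.ofReal_zero] at hlim'
  refine tendsto_of_tendsto_of_tendsto_of_le_of_le tendsto_const_nhds hlim'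
    (fun _ => zero_le) fun n => ?_
  have hn : (0 : ℝ) < n + 1 := by positivity
  simp only
  rw [← ofReal_measureReal]
  refine ENNReal.ofReal_le_ofReal ?_
  refine (lossMeasure_exists_le hd (one_div_succ_pos n) hs0).trans ?_
  have h1 : Real.exp (-s * (δ * Real.log (n + 1))) = (((n : ℝ) + 1) ^ (d + 1))⁻¹ := by
    have h2 : -s * (δ * Real.log (n + 1)) = -(((d + 1 : ℕ) : ℝ) * Real.log (n + 1)) := by
      rw [hs]; push_cast; field_simp
    rw [h2, Real.exp_neg, Real.exp_nat_mul, Real.exp_log hn]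
  have h3 : ((cubeFinset d n).card : ℝ) ≤ 2 ^ d * ((n : ℝ) + 1) ^ d := by
    rw [card_cubeFinset, ← mul_pow]
    push_cast
    exact pow_le_pow_left₀ (by positivity) (by linarith [Nat.cast_nonneg (α := ℝ) n]) d
  rw [h1]
  calc ((cubeFinset d n).card : ℝ) * (2 * ((((n : ℝ) + 1) ^ (d + 1))⁻¹ * K))
      ≤ (2 ^ d * ((n : ℝ) + 1) ^ d) * (2 * ((((n : ℝ) + 1) ^ (d + 1))⁻¹ * K)) := by
        have : 0 < K := Real.exp_pos _
        gcongr
    _ = 2 ^ d * (2 * K) * (1 / ((n : ℝ) + 1)) := by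
        rw [pow_succ]
        field_simp

/-- Since `p ≤ 1`, a lower limit equal to one is a genuine limit, and the error can be subtracted.
-/
lemma liminf_eq_one_of_le_add {p q e : ℕ → ℝ≥0∞} (hp : liminf p atTop = 1) (hp1 : ∀ n, p n ≤ 1)
    (hq1 : ∀ n, q n ≤ 1) (he : Tendsto e atTop (𝓝 0)) (hle : ∀ n, p n ≤ q n + e n) :
    liminf q atTop = 1 := by
  have h1 : Tendsto p atTop (𝓝 1) :=
    tendsto_of_le_liminf_of_limsup_le hp.ge
      (limsup_le_of_le (by isBoundedDefault) (Eventually.of_forall hp1))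
  have h2 : Tendsto (fun n => p n - e n) atTop (𝓝 1) := by
    simpa using ENNReal.Tendsto.sub h1 he (Or.inl ENNReal.one_ne_top)
  exact (tendsto_of_tendsto_of_tendsto_of_le_of_le h2 tendsto_const_nhds
    (fun n => tsub_le_iff_right.2 (hle n)) hq1).liminf_eq

end Errors

end LFPP

/-! ### Comparison of the exponents. -/

theorem lemma1p3 (d d' : ℕ) (hd : 2 ≤ d) (hdd' : d < d') (ξ : ℝ) (hξ : 0 ≤ ξ)
    {Ω Ω' : Type*} [MeasurableSpace Ω] [MeasurableSpace Ω']
    (P : Measure Ω) [IsProbabilityMeasure P] (P' : Measure Ω') [IsProbabilityMeasure P']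
    (h : Ω → (𝓢(LFPP.E d, ℝ) →L[ℝ] ℝ)) (hh : LFPP.IsLGF P h)
    (h' : Ω' → (𝓢(LFPP.E d', ℝ) →L[ℝ] ℝ)) (hh' : LFPP.IsLGF P' h') :
    LFPP.exponent P h ξ ≤ LFPP.exponent P' h' ξ := by
  obtain ⟨k, rfl⟩ := Nat.exists_eq_add_of_le hdd'.le
  refine sSup_le ?_
  rintro _ ⟨a, ha, rfl⟩
  -- It suffices that every `b < a` is admissible in the larger dimension, which leaves room for the
  -- loss `4 δ` with `δ = (a - b) / 4`.
  refine EReal.ge_of_forall_gt_iff_ge.1 fun b hb => ?_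
  refine le_sSup ⟨b, ?_, rfl⟩
  have hδ : 0 < (a - b) / 4 := by
    have : b < a := EReal.coe_lt_coe_iff.1 hb
    linarith
  have he := ((LFPP.tendsto_measure_origin hh hd (ξ := ξ) hδ).add
    (LFPP.tendsto_measure_origin hh' (by omega) (ξ := ξ) hδ)).add
    (LFPP.tendsto_lossMeasure k hd (ξ := ξ) hδ)
  rw [add_zero, add_zero] at he
  refine LFPP.liminf_eq_one_of_le_add ha (fun _ => prob_le_one) (fun _ => prob_le_one) he fun n => ?_
  have h1 := LFPP.measure_crossingDist_le (k := k) hh hh' hd hξ n a ((a - b) / 4)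
  rwa [show a - 4 * ((a - b) / 4) = b by ring] at h1
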